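/- **Setting.** Let $\mathcal H$ be a real Hilbert space, $n\ge 2$, $m,l\ge 0$ integers. Let $A_i:\mathcal H\rightrightarrows\mathcal H$ ($1\le i\le n$) be maximally monotone, $B_j:\mathcal H\to\mathcal H$ ($1\le j\le m$) be $\sigma_j$-cocoercive with $\sigma_j>0$, i.e. $\langle B_jx-B_jy,x-y\rangle\ge\sigma_j\|B_jx-B_jy\|^2$, and $C_j:\mathcal H\to\mathcal H$ ($1\le j\le l$) be monotone and $L_j$-Lipschitz with $L_j>0$. Assume that $\operatorname{zer}\big(\sum_iA_i+\sum_jB_j+\sum_jC_j\big)\ne\varnothing$. Put $\Sigma=\operatorname{diag}(\sigma_1,\dots,\sigma_m)$, $L=\operatorname{diag}(L_1,\dots,L_l)$, let $J_{cA}=(\mathrm{Id}+cA)^{-1}$ denote the resolvent, and let $e_p=(1,\dots,1)^\top\in\mathbb R^p$. **Matrices.** Call $E\in\{0,\dots,q\}^n$ *$(q,n)$-nondecreasing* if $E_1=0$, $E_n=q$ and $E_i\le E_{i+1}$ for $1\le i\le n-1$; for such $E$ let $\mathcal S(E)$ (resp. $\mathcal S^c(E)$) be the set of $X\in\mathbb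 R^{n\times q}$ with $X_{ij}=0$ whenever $j>E_i$ (resp. $j\le E_i$). Let $M\in\mathbb R^{n\times(n-1)}$, $H,G^\top\in\mathbb R^{n\times m}$, $P,Q,R^\top\in\mathbb R^{n\times l}$, $K\in\mathbb R^{n\times n}$ satisfy: (a) $\ker M^\top\subseteq\mathbb Re_n$; (b) $H^\top e_n=Ge_n=e_m$ and $Q^\top e_n=P^\top e_n=Re_n=e_l$; the pair $H,G^\top$ is causal, i.e. $H\in\mathcal S(E)$, $G^\top\in\mathcal S^c(E)$ for some $(m,n)$-nondecreasing $E$; and the triple $P,Q,R^\top$ is relatively causal, i.e. there are $(l,n)$-nondecreasing $E,F$ with $E_{i-1}\ge F_i$ for $2\le i\le n$, $Q\in\mathcal S(F)$, $R^\top\in\mathcal S^c(E)$ and $P\in\mathcal S^c(F)\cap\mathcal S(E)$; (c) $K$ is symmetric, $e_n^\top Ke_n=0$, and $$K-MM^\top-\tfrac12(H-G^\top)\Sigma^{-1}(H^\top-G)-(P-Q)L(P^\top-Q^\top)-(P-R^\top)L(P^\top-R)\succeq0 .$$ Put $d_i=2/K_{ii}$, $D=\operatorname{diag}(d_1,\dots,d_n)$,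 and let $N$ be the negative of the strictly lower triangular part of $K$. **Algorithm.** Let $\gamma_k\in[0,1]$ with $\liminf_{k\to\infty}\gamma_k(1-\gamma_k)>0$, and let $\mathbf z^0\in\mathcal H^{n-1}$ be arbitrary. For $k=0,1,2,\dots$ let, for $i=1,\dots,n$ in this order, $$x_i^k=J_{d_iA_i}\Big(-d_i\sum_{j<i}K_{ij}x_j^k+d_i\sum_{j=1}^{n-1}M_{ij}z_j^k-d_i\sum_{j=1}^mH_{ij}B_j\Big(\sum_{h<i}G_{jh}x_h^k\Big)-d_i\sum_{j=1}^l(P-Q)_{ij}C_j\Big(\sum_{h<i}R_{jh}x_h^k\Big)-d_i\sum_{j=1}^lQ_{ij}C_j\Big(\sum_{h<i}P_{hj}x_h^k\Big)\Big),$$ and let $z_j^{k+1}=z_j^k-\gamma_k\sum_{i=1}^nM_{ij}x_i^k$ for $1\le j\le n-1$. Write $\mathbf z^k=(z^k_1,\dots,z^k_{n-1})$ and $\mathbf x^k=(x^k_1,\dots,x^k_n)$. **The operator $T$.** Let $\gamma>0$ and define $T:\mathcal H^{n-1}\to\mathcal H^{n-1}$ by $T(\mathbf z)=\mathbf z-\gamma\,\mathbf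 M^*\mathbf x$, where $\mathbf x\in\mathcal H^n$ is the unique solution of $$\mathbf x=J_{\mathbf{DA}}\big(\mathbf{DNx}+\mathbf{DMz}-\mathbf{DH}\,\mathbf B(\mathbf{Gx})-\mathbf D(\mathbf P-\mathbf Q)\mathbf C(\mathbf{Rx})-\mathbf{DQ}\,\mathbf C(\mathbf P^*\mathbf x)\big).$$ Here a bold matrix $\mathbf X$ stands for $X\otimes\mathrm{Id}$, $\mathbf B=(B_1,\dots,B_m)$ and $\mathbf C=(C_1,\dots,C_l)$ act componentwise, and $J_{\mathbf{DA}}=(J_{d_1A_1},\dots,J_{d_nA_n})$. **Theorem.** The following hold. (i) $(\mathrm{Id}-T)(\mathbf z^k)\to0$ and $\big\|\frac1{k+1}\sum_{s=0}^k(\mathrm{Id}-T)(\mathbf z^s)\big\|=O(1/\sqrt k)$ as $k\to\infty$; moreover $\sum_{i=1}^nt_ix_i^k\to0$ for all $(t_1,\dots,t_n)\in\mathbb R^n$ with $\sum_{i=1}^nt_i=0$. (ii) $(\mathbf z^k)$ converges weakly to a point $\bar{\mathbf z}\in\operatorname{Fix}T$. (iii) $(\mathbf x^k)$ converges weakly to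 $(\bar x,\dots,\bar x)\in\mathcal H^n$, where $\bar x=J_{d_1A_1}\big(d_1\sum_{j=1}^{n-1}M_{1j}\bar z_j\big)\in\operatorname{zer}\big(\sum_iA_i+\sum_jB_j+\sum_jC_j\big)$. -/

import Mathlib

open Filter Topology Asymptotics
open scoped InnerProductSpace

noncomputable section

namespace Splitting

section Operators

variable {H : Type*} [NormedAddCommGroup H] [InnerProductSpace ℝ H]

/-- A set-valued operator `A : H ⇉ H` is maximally monotone. -/
def MaximallyMonotone (A : H → Set H) : Prop :=
  ∀ x u : H, u ∈ A x ↔ ∀ y v : H, v ∈ A y → 0 ≤ ⟪x - y, u - v⟫_ℝ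

/-- A single-valued operator is monotone. -/
def MonotoneOperator (C : H → H) : Prop :=
  ∀ x y : H, 0 ≤ ⟪C x - C y, x - y⟫_ℝ

/-- `B` is `σ`-cocoercive (with `σ > 0`). -/
def Cocoercive (σ : ℝ) (B : H → H) : Prop :=
  0 < σ ∧ ∀ x y : H, σ * ‖B x - B y‖ ^ 2 ≤ ⟪B x - B y, x - y⟫_ℝ

/-- The resolvent `J_{c A} = (Id + c A)⁻¹`: the point `J_{c A}(u)` is the `p` with
`u ∈ p + c A(p)`. For `A` maximally monotone and `c > 0`, the only case in which it is used,
there is exactly one such `p` for every `u`. -/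
def resolvent (c : ℝ) (A : H → Set H) (u : H) : H :=
  Classical.epsilon fun p : H => ∃ a ∈ A p, p + c • a = u

/-- The zeros of `∑ A_i + ∑ B_i + ∑ C_i`. -/
def zerosOfSum {n m l : ℕ} (A : Fin n → H → Set H) (B : Fin m → H → H) (C : Fin l → H → H) :
    Set H :=
  {x | ∃ a : Fin n → H, (∀ i, a i ∈ A i x) ∧ ∑ i, a i + ∑ j, B j x + ∑ j, C j x = 0}

end Operators

section Matrices

/-- `E` is an `(m, n)`-nondecreasing vector: `E_1 = 0`, `E_n = m`, `E_i ≤ E_{i+1}`. -/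
def NondecreasingVector {n : ℕ} (m : ℕ) (E : Fin n → ℕ) : Prop :=
  (∀ i : Fin n, i.val = 0 → E i = 0) ∧ (∀ i : Fin n, i.val + 1 = n → E i = m) ∧ Monotone E

/-- Staircase structure: `X_{ij} = 0` for `j > E_i`. As columns are numbered from `0` here, the
column with index `j : Fin m` is the `(j + 1)`-st one. -/
def Staircase {n m : ℕ} (E : Fin n → ℕ) (X : Matrix (Fin n) (Fin m) ℝ) : Prop :=
  ∀ i j, E i < j.val + 1 → X i j = 0

/-- Complement staircase structure: `X_{ij} = 0` for `j ≤ E_i` (columns numbered from `1`). -/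
def CoStaircase {n m : ℕ} (E : Fin n → ℕ) (X : Matrix (Fin n) (Fin m) ℝ) : Prop :=
  ∀ i j, j.val + 1 ≤ E i → X i j = 0

/-- The pair `H, Gᵀ` (passed as `X = H`, `Y = Gᵀ`) is causal. -/
def Causal {n m : ℕ} (X Y : Matrix (Fin n) (Fin m) ℝ) : Prop :=
  ∃ E : Fin n → ℕ, NondecreasingVector m E ∧ Staircase E X ∧ CoStaircase E Y

/-- The triple `P, Q, Rᵀ` (passed as `P`, `Q`, `Y = Rᵀ`) is relatively causal. -/
def RelativelyCausal {n m : ℕ} (P Q Y : Matrix (Fin n) (Fin m) ℝ) : Prop :=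
  ∃ E F : Fin n → ℕ, NondecreasingVector m E ∧ NondecreasingVector m F ∧
    (∀ i i' : Fin n, i'.val = i.val + 1 → F i' ≤ E i) ∧
    Staircase F Q ∧ CoStaircase E Y ∧ CoStaircase F P ∧ Staircase E P

/-- The coefficient matrices of the algorithm (data only). -/
structure Coeffs (n m l : ℕ) where
  M : Matrix (Fin n) (Fin (n - 1)) ℝ
  H : Matrix (Fin n) (Fin m) ℝ
  G : Matrix (Fin m) (Fin n) ℝ
  P : Matrix (Fin n) (Fin l) ℝ
  Q : Matrix (Fin n) (Fin l) ℝ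
  R : Matrix (Fin l) (Fin n) ℝ
  K : Matrix (Fin n) (Fin n) ℝ

/-- The standing assumption on the coefficient matrices, for cocoercivity constants `σ` and
Lipschitz constants `L`. -/
structure Coeffs.Admissible {n m l : ℕ} (S : Coeffs n m l) (σ : Fin m → ℝ) (L : Fin l → ℝ) :
    Prop where
  ker_le : LinearMap.ker S.M.transpose.mulVecLin ≤ Submodule.span ℝ {(1 : Fin n → ℝ)}
  H_sum : S.H.transpose.mulVec 1 = 1
  G_sum : S.G.mulVec 1 = 1
  Q_sum : S.Q.transpose.mulVec 1 = 1
  P_sum : S.P.transpose.mulVec 1 = 1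
  R_sum : S.R.mulVec 1 = 1
  causal : Causal S.H S.G.transpose
  relativelyCausal : RelativelyCausal S.P S.Q S.R.transpose
  K_symm : S.K.IsSymm
  K_sum : (1 : Fin n → ℝ) ⬝ᵥ S.K.mulVec 1 = 0
  K_posSemidef : Matrix.PosSemidef
    (S.K - S.M * S.M.transpose
      - (1 / 2 : ℝ) • ((S.H - S.G.transpose) * (Matrix.diagonal σ)⁻¹ * (S.H.transpose - S.G))
      - (S.P - S.Q) * Matrix.diagonal L * (S.P.transpose - S.Q.transpose)
      - (S.P - S.R.transpose) * Matrix.diagonal L * (S.P.transpose - S.R))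

/-- The step sizes `(d_1, …, d_n) = 2 (diag K)^{⊙(-1)}`. -/
def Coeffs.d {n m l : ℕ} (S : Coeffs n m l) (i : Fin n) : ℝ := 2 / S.K i i

/-- `N = -slt(K)`, the negative of the strictly lower triangular part of `K`. -/
def Coeffs.N {n m l : ℕ} (S : Coeffs n m l) : Matrix (Fin n) (Fin n) ℝ :=
  Matrix.of fun i j => if j < i then -S.K i j else 0

end Matrices

section Algorithm

/-- The Hilbert space `H^n`, with the `ℓ²` product inner product and norm. -/
abbrev Power (H : Type*) (n : ℕ) : Type _ := PiLp 2 fun _ : Fin n => H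

theorem existsUnique_of_triangular {H : Type*} [NormedAddCommGroup H] {n : ℕ}
    (f : Power H n → Power H n)
    (hf : ∀ x y i, (∀ h < i, x h = y h) → f x i = f y i) : ∃! x, x = f x := by
  have key : ∀ k : ℕ, ∀ i : Fin n, i.val < k → (f^[k] 0) i = (f^[k + 1] 0) i := by
    intro k
    induction k with
    | zero => intro i hi; omega
    | succ k ih =>
      intro i hi
      rw [Function.iterate_succ_apply' f k, Function.iterate_succ_apply' f (k + 1)]
      exact hf _ _ i fun h hh => ih h (by have := Fin.lt_def.mp hh; omega)
  refine ⟨f^[n] 0, ?_, ?_⟩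
  · ext i
    rw [key n i i.isLt, Function.iterate_succ_apply']
  · intro y hy
    have huniq : ∀ k : ℕ, ∀ i : Fin n, i.val < k → y i = (f^[k] 0) i := by
      intro k
      induction k with
      | zero => intro i hi; omega
      | succ k ih =>
        intro i hi
        rw [Function.iterate_succ_apply' f k]
        have h1 : y i = f y i := congrArg (fun w : Power H n => w i) hy
        rw [h1]
        exact hf _ _ i fun h hh => ih h (by have := Fin.lt_def.mp hh; omega)
    ext i
    exact huniq n i i.isLt

variable {H : Type*} [NormedAddCommGroup H] [InnerProductSpace ℝ H]

/-- The operator `X ⊗ Id : H^q → H^p` of a matrix `X ∈ ℝ^{p × q}`. -/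
def kron {p q : ℕ} (X : Matrix (Fin p) (Fin q) ℝ) (x : Power H q) : Power H p :=
  WithLp.toLp 2 fun i => ∑ j, X i j • x j

/-- The operator `(B_1, …, B_m)` acting componentwise on `H^m`. -/
def blockwise {m : ℕ} (B : Fin m → H → H) (y : Power H m) : Power H m :=
  WithLp.toLp 2 fun j => B j (y j)

variable {n m l : ℕ}

/-- The operator
`x ↦ J_{DA}(D N x + D M z - D H B(G x) - D (P - Q) C(R x) - D Q C(P* x))` on `H^n`, where
`J_{DA} = (J_{d_1 A_1}, …, J_{d_n A_n})` and `D = diag(d_1, …, d_n)`. -/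
def Coeffs.stageMap (S : Coeffs n m l) (A : Fin n → H → Set H) (B : Fin m → H → H)
    (C : Fin l → H → H) (z : Power H (n - 1)) (x : Power H n) : Power H n :=
  WithLp.toLp 2 fun i => resolvent (S.d i) (A i)
    (kron (Matrix.diagonal S.d)
      (kron S.N x + kron S.M z - kron S.H (blockwise B (kron S.G x))
        - kron (S.P - S.Q) (blockwise C (kron S.R x))
        - kron S.Q (blockwise C (kron S.P.transpose x))) i)

theorem causal_apply {n m : ℕ} {X Y : Matrix (Fin n) (Fin m) ℝ}
    (hXY : ∀ i h j, i ≤ h → X i j = 0 ∨ Y h j = 0) (B : Fin m → H → H) {x y : Power H n}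
    {i : Fin n} (hxy : ∀ h < i, x h = y h) :
    kron X (blockwise B (kron Y.transpose x)) i = kron X (blockwise B (kron Y.transpose y)) i := by
  simp only [kron, blockwise, Matrix.transpose_apply]
  refine Finset.sum_congr rfl fun j _ => ?_
  by_cases hX : X i j = 0
  · simp [hX]
  · congr 2
    refine Finset.sum_congr rfl fun h _ => ?_
    rcases lt_or_ge h i with hi | hi
    · rw [hxy h hi]
    · rw [(hXY i h j hi).resolve_left hX, zero_smul, zero_smul]

theorem Coeffs.existsUnique_stagePoint {S : Coeffs n m l} {σ : Fin m → ℝ} {L : Fin l → ℝ}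
    (hS : S.Admissible σ L) (A : Fin n → H → Set H) (B : Fin m → H → H) (C : Fin l → H → H)
    (z : Power H (n - 1)) : ∃! x, x = S.stageMap A B C z x := by
  obtain ⟨E, ⟨-, -, hE⟩, hH, hG⟩ := hS.causal
  obtain ⟨E', F, ⟨h0, -, hE'⟩, ⟨hF0, -, hF⟩, hEF, hQ, hR, hPF, hPE⟩ := hS.relativelyCausal
  have hFE : ∀ i h : Fin n, i ≤ h → F i ≤ E' h := by
    intro i h hih
    rcases Nat.eq_zero_or_pos i.val with hi | hi
    · rw [hF0 i hi]; exact Nat.zero_le _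
    · exact (hEF ⟨i.val - 1, by omega⟩ i (by simp; omega)).trans
        (hE' (Fin.le_def.mpr (by have := Fin.le_def.mp hih; simp; omega)))
  have c1 : ∀ i h j, i ≤ h → S.H i j = 0 ∨ S.G.transpose h j = 0 := by
    intro i h j hih
    rcases lt_or_ge (E i) (j.val + 1) with hj | hj
    · exact Or.inl (hH i j hj)
    · exact Or.inr (hG h j (hj.trans (hE hih)))
  have c2 : ∀ i h j, i ≤ h → (S.P - S.Q) i j = 0 ∨ S.R.transpose h j = 0 := by
    intro i h j hih
    rcases lt_or_ge (E' h) (j.val + 1) with hj | hj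
    · refine Or.inl ?_
      rw [Matrix.sub_apply, hPE i j ((hE' hih).trans_lt hj),
        hQ i j ((hFE i h hih).trans_lt hj), sub_zero]
    · exact Or.inr (hR h j hj)
  have c3 : ∀ i h j, i ≤ h → S.Q i j = 0 ∨ S.P h j = 0 := by
    intro i h j hih
    rcases lt_or_ge (F i) (j.val + 1) with hj | hj
    · exact Or.inl (hQ i j hj)
    · exact Or.inr (hPF h j (hj.trans (hF hih)))
  refine existsUnique_of_triangular _ fun x y i hxy => ?_
  have e0 : kron S.N x i = kron S.N y i := by
    simp only [kron, Coeffs.N, Matrix.of_apply]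
    refine Finset.sum_congr rfl fun h _ => ?_
    split_ifs with hh
    · rw [hxy h hh]
    · simp
  have e1 := causal_apply c1 B hxy
  have e2 := causal_apply c2 C hxy
  have e3 := causal_apply c3 C hxy
  rw [Matrix.transpose_transpose] at e1 e2
  simp only [stageMap]
  congr 1
  have hd : ∀ w : Power H n, kron (Matrix.diagonal S.d) w i = S.d i • w i := by
    intro w
    simp [kron, Matrix.diagonal_apply, ite_smul]
  rw [hd, hd]
  simp only [PiLp.sub_apply, PiLp.add_apply, e0, e1, e2, e3]

/-- The point `x = x(z) ∈ H^n` which solves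
`x = J_{DA}(D N x + D M z - D H B(G x) - D (P - Q) C(R x) - D Q C(P* x))`. If the matrices are
causal, the right-hand side is strictly lower triangular in `x`, so there is exactly one such `x`
(see `Coeffs.existsUnique_stagePoint`). -/
def Coeffs.stagePoint (S : Coeffs n m l) (A : Fin n → H → Set H) (B : Fin m → H → H)
    (C : Fin l → H → H) (z : Power H (n - 1)) : Power H n :=
  Classical.epsilon fun x : Power H n => x = S.stageMap A B C z x

/-- The fixed point operator `T(z) = z - γ M* x(z)`. -/
def Coeffs.T (S : Coeffs n m l) (A : Fin n → H → Set H) (B : Fin m → H → H)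
    (C : Fin l → H → H) (γ : ℝ) (z : Power H (n - 1)) : Power H (n - 1) :=
  z - γ • kron S.M.transpose (S.stagePoint A B C z)

/-- The sequences `z^k ∈ H^{n-1}`, `x^k ∈ H^n` are generated by the algorithm with relaxation
parameters `γ_k` (and arbitrary starting point `z^0`). -/
structure Coeffs.Generates (S : Coeffs n m l) (A : Fin n → H → Set H) (B : Fin m → H → H)
    (C : Fin l → H → H) (γ : ℕ → ℝ) (z : ℕ → Power H (n - 1)) (x : ℕ → Power H n) : Prop where
  x_eq : ∀ (k : ℕ) (i : Fin n), x k i = resolvent (S.d i) (A i)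
    (-(S.d i • ∑ j ∈ Finset.Iio i, S.K i j • x k j)
      + S.d i • ∑ j, S.M i j • z k j
      - S.d i • ∑ j, S.H i j • B j (∑ h ∈ Finset.Iio i, S.G j h • x k h)
      - S.d i • ∑ j, (S.P i j - S.Q i j) • C j (∑ h ∈ Finset.Iio i, S.R j h • x k h)
      - S.d i • ∑ j, S.Q i j • C j (∑ h ∈ Finset.Iio i, S.P h j • x k h))
  z_eq : ∀ (k : ℕ) (j : Fin (n - 1)), z (k + 1) j = z k j - γ k • ∑ i, S.M i j • x k i

end Algorithm

end Splitting

end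

/-! Since d_i K_ii / 2 = 1, the stage equation is an inclusion: the vector a = `S.lower` x + Mz - H
B(Gx) - (P - Q) C(Rx) - Q C(P*x) (`Coeffs.selection`) satisfies a_i ∈ A_i(x_i), where `S.lower` plus
its transpose is -K. Solutions whose stages all equal one point u correspond to zeros u of the sum;
let Ω be the set of parameters z of such solutions.

For a stage solution (z, x) and p ∈ Ω, monotonicity of the A_i, cocoercivity of the B_j, the
Lipschitz and monotonicity bounds for the C_j and assumption (c) combine to ‖M*x‖² ≤ 2⟨z - p, M*x⟩
(`Coeffs.Admissible.norm_sq_le_inner`). Hence ‖z^{k+1} - p‖² + γ_k(1 - γ_k)‖M*x^k‖² ≤ ‖z^k - p‖²: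
the iterates are Fejér monotone with respect to Ω and ‖M*x^k‖² is summable. This gives (i), because
(Id - T)z^k = γ M*x^k and every t with Σ t_i = 0 lies in the range of M.

In particular all stages become asymptotically equal. Treating the A_i, B_j and C_j as one family of
maximally monotone operators, a demiclosedness principle (`mem_of_tendstoWeakly`) puts every weak
cluster point of (z^k) in Ω, and Opial's lemma (`exists_tendstoWeakly_of_fejer`) gives (ii). The
first stage depends on z only, through one resolvent; this determines the weak cluster points of
(x^k) from the limit of (z^k) and gives (iii). -/

namespace Splitting

/-! ### Minimisation of a strongly convex function over an epigraph. -/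

section StronglyConvex

variable {V : Type*} [NormedAddCommGroup V] [InnerProductSpace ℝ V]

/-- The function `(v, r) ↦ r + ‖v‖² / 2` attains its minimum on a closed convex set on which it is
bounded below, and the minimum satisfies the first order optimality condition. -/
theorem exists_forall_sub_inner_le [CompleteSpace V] {s : Set (V × ℝ)} (hne : s.Nonempty)
    (hcl : IsClosed s) (hcv : Convex ℝ s) {β : ℝ} (hβ : ∀ w ∈ s, β ≤ w.2 + ‖w.1‖ ^ 2 / 2) :
    ∃ w₀ ∈ s, ∀ w ∈ s, w₀.2 - ⟪w₀.1, w.1 - w₀.1⟫_ℝ ≤ w.2 := by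
  set f : V × ℝ → ℝ := fun w => w.2 + ‖w.1‖ ^ 2 / 2 with hf
  have hfc : Continuous f := by fun_prop
  have hbdd : BddBelow (f '' s) := ⟨β, by rintro _ ⟨w, hw, rfl⟩; exact hβ w hw⟩
  set μ := sInf (f '' s) with hμ
  have hμle : ∀ w ∈ s, μ ≤ f w := fun w hw => csInf_le hbdd ⟨w, hw, rfl⟩
  have hex : ∀ k : ℕ, ∃ w ∈ s, f w < μ + 1 / ((k : ℝ) + 1) := by
    intro k
    obtain ⟨_, ⟨w, hw, rfl⟩, h⟩ := exists_lt_of_csInf_lt (hne.image f)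
      (show sInf (f '' s) < μ + 1 / ((k : ℝ) + 1) from lt_add_of_pos_right _ (by positivity))
    exact ⟨w, hw, h⟩
  choose w hws hwf using hex
  -- Strong convexity at the midpoint, via the parallelogram law: minimising sequences are Cauchy in
  -- the `V` component.
  have hmid : ∀ p ∈ s, ∀ q ∈ s, ‖p.1 - q.1‖ ^ 2 ≤ 4 * (f p - μ) + 4 * (f q - μ) := by
    intro p hp q hq
    have hm := hμle _ (hcv hp hq (by norm_num : (0 : ℝ) ≤ 1 / 2) (by norm_num : (0 : ℝ) ≤ 1 / 2)
      (by norm_num))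
    have e : (1 / 2 : ℝ) • p.1 + (1 / 2 : ℝ) • q.1 = (1 / 2 : ℝ) • (p.1 + q.1) := by
      rw [smul_add]
    simp only [hf, Prod.fst_add, Prod.snd_add, Prod.smul_fst, Prod.smul_snd, e, norm_smul,
      smul_eq_mul] at hm ⊢
    rw [mul_pow] at hm
    have := parallelogram_law_with_norm ℝ p.1 q.1
    norm_num at hm
    nlinarith
  have hone : Tendsto (fun k : ℕ => 1 / ((k : ℝ) + 1)) atTop (𝓝 0) :=
    tendsto_one_div_add_atTop_nhds_zero_nat
  have hcau : CauchySeq fun k => (w k).1 := by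
    refine cauchySeq_of_le_tendsto_0 (fun N : ℕ => √(8 * (1 / ((N : ℝ) + 1)))) ?_ ?_
    · intro k j N hk hj
      rw [dist_eq_norm]
      refine Real.le_sqrt_of_sq_le ((hmid _ (hws k) _ (hws j)).trans ?_)
      have h1 : 1 / ((k : ℝ) + 1) ≤ 1 / ((N : ℝ) + 1) := Nat.one_div_le_one_div hk
      have h2 : 1 / ((j : ℝ) + 1) ≤ 1 / ((N : ℝ) + 1) := Nat.one_div_le_one_div hj
      linarith [hwf k, hwf j]
    · have := (hone.const_mul 8).sqrt
      simpa using this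
  obtain ⟨v, hv⟩ := cauchySeq_tendsto_of_complete hcau
  have hfw : Tendsto (fun k => f (w k)) atTop (𝓝 μ) :=
    tendsto_of_tendsto_of_tendsto_of_le_of_le tendsto_const_nhds
      (by simpa using hone.const_add μ) (fun k => hμle _ (hws k)) fun k => (hwf k).le
  have hr : Tendsto (fun k => (w k).2) atTop (𝓝 (μ - ‖v‖ ^ 2 / 2)) := by
    have := hfw.sub ((hv.norm.pow 2).div_const 2)
    simpa [hf] using this
  have hmem : (v, μ - ‖v‖ ^ 2 / 2) ∈ s :=
    hcl.mem_of_tendsto (hv.prodMk_nhds hr) (Eventually.of_forall hws)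
  refine ⟨_, hmem, fun u hu => ?_⟩
  -- Compare the minimiser with the point at parameter t on the segment towards u, divide by t, and
  -- let t tend to 0.
  have key : ∀ t ∈ Set.Ioc (0 : ℝ) 1,
      0 ≤ u.2 - (μ - ‖v‖ ^ 2 / 2) + ⟪v, u.1 - v⟫_ℝ + t * (‖u.1 - v‖ ^ 2 / 2) := by
    rintro t ⟨ht0, ht1⟩
    have h := hμle _ (hcv hmem hu (sub_nonneg.mpr ht1) ht0.le (by ring))
    have e : (1 - t) • v + t • u.1 = v + t • (u.1 - v) := by
      rw [smul_sub, sub_smul, one_smul]; abel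
    simp only [hf, Prod.fst_add, Prod.snd_add, Prod.smul_fst, Prod.smul_snd, e, smul_eq_mul,
      norm_add_sq_real, norm_smul, inner_smul_right, mul_pow, Real.norm_eq_abs, sq_abs] at h
    have : 0 ≤ t * (u.2 - (μ - ‖v‖ ^ 2 / 2) + ⟪v, u.1 - v⟫_ℝ + t * (‖u.1 - v‖ ^ 2 / 2)) := by
      nlinarith
    exact nonneg_of_mul_nonneg_right this ht0
  have hlim : Tendsto (fun t : ℝ =>
      u.2 - (μ - ‖v‖ ^ 2 / 2) + ⟪v, u.1 - v⟫_ℝ + t * (‖u.1 - v‖ ^ 2 / 2)) (𝓝[>] 0)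
      (𝓝 (u.2 - (μ - ‖v‖ ^ 2 / 2) + ⟪v, u.1 - v⟫_ℝ)) := by
    have : Continuous fun t : ℝ =>
      u.2 - (μ - ‖v‖ ^ 2 / 2) + ⟪v, u.1 - v⟫_ℝ + t * (‖u.1 - v‖ ^ 2 / 2) := by fun_prop
    simpa using (this.tendsto 0).mono_left nhdsWithin_le_nhds
  have := ge_of_tendsto hlim (by
    filter_upwards [Ioc_mem_nhdsGT (zero_lt_one' ℝ)] with t ht using key t ht)
  simp only
  linarith

end StronglyConvex

/-! ### Minty's theorem, resolvents, and maximality of continuous monotone maps. -/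

section Resolvent

variable {H : Type*} [NormedAddCommGroup H] [InnerProductSpace ℝ H]

theorem MaximallyMonotone.inner_nonneg {A : H → Set H} (hA : MaximallyMonotone A) {x y u v : H}
    (hu : u ∈ A x) (hv : v ∈ A y) : 0 ≤ ⟪x - y, u - v⟫_ℝ :=
  (hA x u).1 hu y v hv

/-- Minty's theorem for the operator `Id + A`. -/
theorem MaximallyMonotone.exists_neg_mem [CompleteSpace H] {A : H → Set H}
    (hA : MaximallyMonotone A) : ∃ x, -x ∈ A x := by
  -- The epigraph of the Fitzpatrick function of `A`. It dominates the duality pairing (`hlow`), so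
  -- adding half the squared norm makes it nonnegative.
  let s : Set (WithLp 2 (H × H) × ℝ) := {w | ∀ y v, v ∈ A y →
    ⟪w.1.fst, v⟫_ℝ + ⟪y, w.1.snd⟫_ℝ - ⟪y, v⟫_ℝ ≤ w.2}
  obtain ⟨y₀, v₀, h₀⟩ : ∃ y v, v ∈ A y := by
    by_contra! h
    exact h 0 0 ((hA 0 0).2 fun y v hv => absurd hv (h y v))
  have hgr : ∀ y v, v ∈ A y → ((WithLp.toLp 2 (y, v) : WithLp 2 (H × H)), ⟪y, v⟫_ℝ) ∈ s := by
    intro y v hv y' v' hv'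
    have := hA.inner_nonneg hv hv'
    simp only [inner_sub_left, inner_sub_right] at this
    change ⟪y, v'⟫_ℝ + ⟪y', v⟫_ℝ - ⟪y', v'⟫_ℝ ≤ ⟪y, v⟫_ℝ
    linarith
  have hlow : ∀ w ∈ s, ⟪w.1.fst, w.1.snd⟫_ℝ ≤ w.2 := by
    intro w hw
    by_cases h : w.1.snd ∈ A w.1.fst
    · have := hw _ _ h
      linarith
    · rw [hA] at h
      push Not at h
      obtain ⟨y, v, hv, h⟩ := h
      have := hw y v hv
      simp only [inner_sub_left, inner_sub_right] at h
      linarith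
  have hcl : IsClosed s := by
    simp only [s, Set.ofPred_forall]
    refine isClosed_iInter fun y => isClosed_iInter fun v => isClosed_iInter fun _ => ?_
    have h1 : Continuous fun w : WithLp 2 (H × H) × ℝ => w.1.fst :=
      (WithLp.continuous_fst ..).comp continuous_fst
    have h2 : Continuous fun w : WithLp 2 (H × H) × ℝ => w.1.snd :=
      (WithLp.continuous_snd ..).comp continuous_fst
    exact isClosed_le (by fun_prop) continuous_snd
  have hcv : Convex ℝ s := by
    intro p hp q hq a b ha hb hab y v hv
    have h1 := mul_le_mul_of_nonneg_left (hp y v hv) ha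
    have h2 := mul_le_mul_of_nonneg_left (hq y v hv) hb
    have h3 : ⟪y, v⟫_ℝ = a * ⟪y, v⟫_ℝ + b * ⟪y, v⟫_ℝ := by rw [← add_mul, hab, one_mul]
    simp only [Prod.fst_add, Prod.snd_add, Prod.smul_fst, Prod.smul_snd, WithLp.add_fst,
      WithLp.add_snd, WithLp.smul_fst, WithLp.smul_snd, inner_add_left, inner_add_right,
      inner_smul_left, inner_smul_right, smul_eq_mul, RCLike.conj_to_real]
    linarith
  have hnorm : ∀ w : WithLp 2 (H × H), ‖w‖ ^ 2 = ‖w.fst‖ ^ 2 + ‖w.snd‖ ^ 2 := WithLp.prod_norm_sq_eq_of_L2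
  obtain ⟨w₀, hw₀, hmin⟩ := exists_forall_sub_inner_le (β := 0) ⟨_, hgr y₀ v₀ h₀⟩ hcl hcv (by
    intro w hw
    have h1 := hlow w hw
    have h2 := norm_add_sq_real w.1.fst w.1.snd
    rw [hnorm]
    nlinarith [sq_nonneg ‖w.1.fst + w.1.snd‖])
  -- For the minimiser (x, u), optimality and `hlow` show that (-u, -x) is monotonically related to
  -- the graph, hence lies in it. Testing at this very point forces x + u = 0.
  have key : ∀ y v, v ∈ A y →
      ‖w₀.1.fst + w₀.1.snd‖ ^ 2 ≤ ⟪-w₀.1.snd - y, -w₀.1.fst - v⟫_ℝ := by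
    intro y v hv
    have h := hmin _ (hgr y v hv)
    have h1 := hlow w₀ hw₀
    have h2 := norm_add_sq_real w₀.1.fst w₀.1.snd
    simp only [WithLp.prod_inner_apply, WithLp.ofLp_fst,
      WithLp.ofLp_snd, inner_sub_left, inner_sub_right, inner_neg_left, inner_neg_right,
      real_inner_self_eq_norm_sq] at h ⊢
    rw [real_inner_comm w₀.1.fst w₀.1.snd, real_inner_comm w₀.1.fst y]
    linarith
  have hm : -w₀.1.fst ∈ A (-w₀.1.snd) := (hA _ _).2 fun y v hv => (sq_nonneg _).trans (key y v hv)
  have h0 := key _ _ hm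
  simp only [sub_self, inner_zero_left] at h0
  have h1 : w₀.1.fst + w₀.1.snd = 0 := by
    rw [← norm_eq_zero]; exact pow_eq_zero_iff (two_ne_zero) |>.1 (le_antisymm h0 (sq_nonneg _))
  have h2 : -w₀.1.snd = w₀.1.fst := neg_eq_of_add_eq_zero_left h1
  exact ⟨w₀.1.fst, by rwa [h2] at hm⟩

/-- The operator cA - u is again maximally monotone, so the case of `Id + A` applies to it. -/
theorem MaximallyMonotone.exists_add_smul_eq [CompleteSpace H] {A : H → Set H}
    (hA : MaximallyMonotone A) {c : ℝ} (hc : 0 < c) (u : H) : ∃ p, ∃ a ∈ A p, p + c • a = u := by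
  have hA' : MaximallyMonotone fun y => {w | c⁻¹ • (w + u) ∈ A y} := by
    intro x w
    simp only [Set.mem_ofPred_eq]
    rw [hA]
    constructor
    · intro h y v hv
      have := h y _ hv
      rw [← smul_sub, inner_smul_right, add_sub_add_right_eq_sub] at this
      exact nonneg_of_mul_nonneg_right this (inv_pos.2 hc)
    · intro h y v hv
      have := h y (c • v - u) (by rwa [sub_add_cancel, inv_smul_smul₀ hc.ne'])
      have e : c⁻¹ • (w + u) - v = c⁻¹ • (w - (c • v - u)) := by
        rw [sub_sub_eq_add_sub, smul_sub, inv_smul_smul₀ hc.ne']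
      rw [e, inner_smul_right]
      exact mul_nonneg (inv_pos.2 hc).le this
  obtain ⟨x, hx⟩ := hA'.exists_neg_mem
  refine ⟨x, _, hx, ?_⟩
  rw [smul_inv_smul₀ hc.ne']
  abel

theorem MaximallyMonotone.resolvent_spec [CompleteSpace H] {A : H → Set H}
    (hA : MaximallyMonotone A) {c : ℝ} (hc : 0 < c) (u : H) :
    ∃ a ∈ A (resolvent c A u), resolvent c A u + c • a = u :=
  Classical.epsilon_spec (hA.exists_add_smul_eq hc u)

theorem MaximallyMonotone.norm_sub_le {A : H → Set H} (hA : MaximallyMonotone A) {c : ℝ}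
    (hc : 0 < c) {p q a b : H} (ha : a ∈ A p) (hb : b ∈ A q) :
    ‖p - q‖ ≤ ‖(p + c • a) - (q + c • b)‖ := by
  have h := mul_nonneg hc.le (hA.inner_nonneg ha hb)
  have e : (p + c • a) - (q + c • b) = (p - q) + c • (a - b) := by rw [smul_sub]; abel
  refine le_of_sq_le_sq ?_ (norm_nonneg _)
  rw [e, norm_add_sq_real, inner_smul_right]
  nlinarith [sq_nonneg ‖c • (a - b)‖]

theorem MaximallyMonotone.resolvent_eq [CompleteSpace H] {A : H → Set H}
    (hA : MaximallyMonotone A) {c : ℝ} (hc : 0 < c) {p a : H} (ha : a ∈ A p) :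
    resolvent c A (p + c • a) = p := by
  obtain ⟨b, hb, h⟩ := hA.resolvent_spec hc (p + c • a)
  have := hA.norm_sub_le hc hb ha
  rw [h, sub_self, norm_zero] at this
  exact sub_eq_zero.1 (norm_le_zero_iff.1 this)

theorem MaximallyMonotone.norm_resolvent_sub_le [CompleteSpace H] {A : H → Set H}
    (hA : MaximallyMonotone A) {c : ℝ} (hc : 0 < c) (u v : H) :
    ‖resolvent c A u - resolvent c A v‖ ≤ ‖u - v‖ := by
  obtain ⟨a, ha, hu⟩ := hA.resolvent_spec hc u
  obtain ⟨b, hb, hv⟩ := hA.resolvent_spec hc v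
  simpa only [hu, hv] using hA.norm_sub_le hc ha hb

/-- Continuous monotone operators are maximally monotone. -/
theorem MonotoneOperator.maximallyMonotone {C : H → H} (hC : MonotoneOperator C)
    (hcont : Continuous C) : MaximallyMonotone fun x => {C x} := by
  intro x u
  simp only [Set.mem_singleton_iff]
  constructor
  · rintro rfl y v rfl
    rw [real_inner_comm]
    exact hC x y
  · intro h
    -- Minty's trick: test at x + te, divide by t, and let t tend to 0; continuity leaves ‖e‖² ≤ 0.
    set e := u - C x with he
    have key : ∀ t ∈ Set.Ioi (0 : ℝ), ⟪e, u - C (x + t • e)⟫_ℝ ≤ 0 := by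
      intro t ht
      have := h (x + t • e) _ rfl
      rw [sub_add_cancel_left, inner_neg_left, inner_smul_left] at this
      simp only [RCLike.conj_to_real] at this
      have h2 : t * ⟪e, u - C (x + t • e)⟫_ℝ ≤ 0 := by linarith
      exact nonpos_of_mul_nonpos_right h2 ht
    have hlim : Tendsto (fun t : ℝ => ⟪e, u - C (x + t • e)⟫_ℝ) (𝓝[>] 0) (𝓝 ⟪e, e⟫_ℝ) := by
      have : Continuous fun t : ℝ => ⟪e, u - C (x + t • e)⟫_ℝ := by fun_prop
      simpa [he] using (this.tendsto 0).mono_left nhdsWithin_le_nhds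
    have := le_of_tendsto hlim (eventually_mem_nhdsWithin.mono key)
    rw [real_inner_self_eq_norm_sq] at this
    exact sub_eq_zero.1 (norm_eq_zero.1 (pow_eq_zero_iff two_ne_zero |>.1 (this.antisymm (sq_nonneg _))))

theorem Cocoercive.monotoneOperator {σ : ℝ} {B : H → H} (hB : Cocoercive σ B) :
    MonotoneOperator B := fun x y => (mul_nonneg hB.1.le (sq_nonneg _)).trans (hB.2 x y)

theorem Cocoercive.norm_sub_le {σ : ℝ} {B : H → H} (hB : Cocoercive σ B) (x y : H) :
    ‖B x - B y‖ ≤ σ⁻¹ * ‖x - y‖ := by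
  have h1 := (hB.2 x y).trans (real_inner_le_norm _ _)
  have hσ := hB.1
  rw [inv_mul_eq_div, le_div_iff₀ hσ]
  rcases (norm_nonneg (B x - B y)).eq_or_lt with h | h
  · rw [← h, zero_mul]; exact norm_nonneg _
  · nlinarith

theorem Cocoercive.lipschitzWith {σ : ℝ} {B : H → H} (hB : Cocoercive σ B) :
    LipschitzWith σ⁻¹.toNNReal B :=
  LipschitzWith.of_dist_le_mul fun x y => by
    rw [dist_eq_norm, dist_eq_norm, Real.coe_toNNReal _ (inv_pos.2 hB.1).le]
    exact hB.norm_sub_le x y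

end Resolvent

/-! ### Weak convergence along filters. -/

section Weak

variable {V : Type*} [NormedAddCommGroup V] [InnerProductSpace ℝ V] {ι : Type*}

/-- Weak convergence in an inner product space, expressed with inner products. -/
def TendstoWeakly (f : ι → V) (F : Filter ι) (v : V) : Prop :=
  ∀ y, Tendsto (fun k => ⟪y, f k⟫_ℝ) F (𝓝 ⟪y, v⟫_ℝ)

variable {F : Filter ι} {f g : ι → V} {v w : V}

theorem TendstoWeakly.of_tendsto (h : Tendsto f F (𝓝 v)) : TendstoWeakly f F v :=
  fun _ => tendsto_const_nhds.inner h

theorem TendstoWeakly.add (hf : TendstoWeakly f F v) (hg : TendstoWeakly g F w) :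
    TendstoWeakly (fun k => f k + g k) F (v + w) := fun y => by
  simpa only [inner_add_right] using (hf y).add (hg y)

theorem TendstoWeakly.sub (hf : TendstoWeakly f F v) (hg : TendstoWeakly g F w) :
    TendstoWeakly (fun k => f k - g k) F (v - w) := fun y => by
  simpa only [inner_sub_right] using (hf y).sub (hg y)

theorem TendstoWeakly.const_smul (hf : TendstoWeakly f F v) (c : ℝ) :
    TendstoWeakly (fun k => c • f k) F (c • v) := fun y => by
  simpa only [inner_smul_right] using (hf y).const_mul c

theorem TendstoWeakly.sum {κ : Type*} [Fintype κ] {f : κ → ι → V} {v : κ → V}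
    (h : ∀ i, TendstoWeakly (f i) F (v i)) :
    TendstoWeakly (fun k => ∑ i, f i k) F (∑ i, v i) := fun y => by
  simpa only [inner_sum] using tendsto_finsetSum _ fun i _ => h i y

theorem TendstoWeakly.unique [NeBot F] (hf : TendstoWeakly f F v) (hg : TendstoWeakly f F w) :
    v = w :=
  ext_inner_left ℝ fun y => tendsto_nhds_unique (hf y) (hg y)

theorem TendstoWeakly.of_sub (hf : TendstoWeakly f F v)
    (h : Tendsto (fun k => g k - f k) F (𝓝 0)) : TendstoWeakly g F v := by
  simpa using (TendstoWeakly.of_tendsto h).add hf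

/-- The bound on `f` is a separate hypothesis because weak convergence along a general filter does
not imply boundedness. -/
theorem TendstoWeakly.inner (hf : TendstoWeakly f F v) {R : ℝ} (hR : ∀ k, ‖f k‖ ≤ R)
    (hg : Tendsto g F (𝓝 w)) : Tendsto (fun k => ⟪f k, g k⟫_ℝ) F (𝓝 ⟪v, w⟫_ℝ) := by
  have h1 : Tendsto (fun k => ⟪f k, g k - w⟫_ℝ) F (𝓝 0) := by
    have h0 : Tendsto (fun k => R * ‖g k - w‖) F (𝓝 0) := by
      simpa using (tendsto_iff_norm_sub_tendsto_zero.1 hg).const_mul R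
    refine squeeze_zero_norm (fun k => ?_) h0
    exact (norm_inner_le_norm _ _).trans (mul_le_mul_of_nonneg_right (hR k) (norm_nonneg _))
  have h2 := h1.add (hf w)
  simp only [inner_sub_right, real_inner_comm _ w, sub_add_cancel, zero_add] at h2
  exact h2

/-- Weak compactness of balls: the limits of the bounded scalars ⟪y, f k⟫ along the ultrafilter form
a bounded linear functional of y, represented by Riesz. Ultrafilters take the place of subsequences.
-/
theorem exists_tendstoWeakly [CompleteSpace V] (U : Ultrafilter ι) {R : ℝ}
    (hR : ∀ k, ‖f k‖ ≤ R) : ∃ v, TendstoWeakly f U v := by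
  have h : ∀ y, ∃ c ∈ Set.Icc (-(‖y‖ * R)) (‖y‖ * R),
      Tendsto (fun k => ⟪y, f k⟫_ℝ) U (𝓝 c) := by
    intro y
    refine isCompact_Icc.ultrafilter_le_nhds (U.map fun k => ⟪y, f k⟫_ℝ) ?_
    rw [Ultrafilter.coe_map, le_principal_iff]
    refine Filter.mem_map.2 (univ_mem' fun k => ?_)
    exact abs_le.1 ((abs_real_inner_le_norm y (f k)).trans
      (mul_le_mul_of_nonneg_left (hR k) (norm_nonneg _)))
  choose φ hφ hlim using h
  let Φ : V →ₗ[ℝ] ℝ :=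
    { toFun := φ
      map_add' := fun y y' => tendsto_nhds_unique (hlim _) (by
        simpa only [inner_add_left] using (hlim y).add (hlim y'))
      map_smul' := fun c y => tendsto_nhds_unique (hlim _) (by
        simpa only [real_inner_smul_left] using! (hlim y).const_mul c) }
  let Ψ := Φ.mkContinuous R fun y => by
    rw [mul_comm]
    exact abs_le.2 (hφ y)
  refine ⟨(InnerProductSpace.toDual ℝ V).symm Ψ, fun y => ?_⟩
  rw [real_inner_comm, InnerProductSpace.toDual_symm_apply]
  exact hlim y

theorem TendstoWeakly.tendsto_toWeakSpace [CompleteSpace V] (hf : TendstoWeakly f F v) :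
    Tendsto (fun k => toWeakSpace ℝ V (f k)) F (𝓝 (toWeakSpace ℝ V v)) := by
  refine (WeakBilin.tendsto_iff_forall_eval_tendsto (topDualPairing ℝ V).flip ?_).2 fun φ => ?_
  · intro a b hab
    refine ext_inner_left ℝ fun y => ?_
    exact DFunLike.congr_fun hab (InnerProductSpace.toDual ℝ V y)
  · have := hf ((InnerProductSpace.toDual ℝ V).symm φ)
    simp only [InnerProductSpace.toDual_symm_apply] at this
    exact this

theorem TendstoWeakly.apply {H : Type*} [NormedAddCommGroup H] [InnerProductSpace ℝ H] {n : ℕ}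
    {f : ι → Power H n} {v : Power H n} (hf : TendstoWeakly f F v) (i : Fin n) :
    TendstoWeakly (fun k => f k i) F (v i) := fun y => by
  have e : ∀ u : Power H n, ⟪(PiLp.single 2 i y : Power H n), u⟫_ℝ = ⟪y, u i⟫_ℝ := fun u => by
    rw [PiLp.inner_apply, Finset.sum_eq_single i]
    · simp
    · intro j _ hj
      simp [hj]
    · simp
  simpa only [e] using hf (PiLp.single 2 i y)

theorem TendstoWeakly.of_apply {H : Type*} [NormedAddCommGroup H] [InnerProductSpace ℝ H] {n : ℕ}
    {f : ι → Power H n} {v : Power H n} (hf : ∀ i, TendstoWeakly (fun k => f k i) F (v i)) :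
    TendstoWeakly f F v := fun y => by
  simp only [PiLp.inner_apply]
  exact tendsto_finsetSum _ fun i _ => hf i (y i)

end Weak

/-! ### Demiclosedness for families of maximally monotone operators. -/

section Demiclosed

variable {H : Type*} [NormedAddCommGroup H] [InnerProductSpace ℝ H] {κ : Type*} [Fintype κ]

/-- A finite product of maximally monotone operators is maximally monotone. -/
theorem mem_of_forall_sum_inner_nonneg {A : κ → H → Set H} (hA : ∀ i, MaximallyMonotone (A i))
    {x a : κ → H}
    (h : ∀ y v : κ → H, (∀ i, v i ∈ A i (y i)) → 0 ≤ ∑ i, ⟪x i - y i, a i - v i⟫_ℝ) (i : κ) :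
    a i ∈ A i (x i) := by
  by_contra hi
  -- Test pairs: the point itself where membership holds (contributing 0), a violating pair
  -- elsewhere (contributing a negative number).
  have hex : ∀ j, ∃ p : H × H, p.2 ∈ A j p.1 ∧ ⟪x j - p.1, a j - p.2⟫_ℝ ≤ 0 ∧
      (a j ∉ A j (x j) → ⟪x j - p.1, a j - p.2⟫_ℝ < 0) := by
    intro j
    by_cases hj : a j ∈ A j (x j)
    · exact ⟨(x j, a j), hj, by simp, fun h => absurd hj h⟩
    · have hj' := hj
      rw [hA] at hj'
      push Not at hj'
      obtain ⟨y, v, hv, hlt⟩ := hj'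
      exact ⟨(y, v), hv, hlt.le, fun _ => hlt⟩
  choose p hp hle hlt using hex
  have h1 := h (fun j => (p j).1) (fun j => (p j).2) hp
  have h2 : ∑ j, ⟪x j - (p j).1, a j - (p j).2⟫_ℝ < 0 :=
    Finset.sum_neg' (fun j _ => hle j) ⟨i, Finset.mem_univ _, hlt i hi⟩
  linarith

/-- Demiclosedness principle for finitely many maximally monotone operators. -/
theorem mem_of_tendstoWeakly {A : κ → H → Set H} (hA : ∀ i, MaximallyMonotone (A i))
    {ι : Type*} {F : Filter ι} [NeBot F] {x a : κ → ι → H} (hxa : ∀ i k, a i k ∈ A i (x i k))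
    {w : ι → H} {R R' : ℝ} (hwR : ∀ k, ‖w k‖ ≤ R) (haR : ∀ i k, ‖a i k‖ ≤ R') {xbar s : H}
    {abar : κ → H} (hw : TendstoWeakly w F xbar)
    (hx : ∀ i, Tendsto (fun k => x i k - w k) F (𝓝 0))
    (ha : ∀ i, TendstoWeakly (a i) F (abar i))
    (hs : Tendsto (fun k => ∑ i, a i k) F (𝓝 s)) (i : κ) : abar i ∈ A i xbar := by
  have hsum : ∑ i, abar i = s := (TendstoWeakly.sum ha).unique (.of_tendsto hs)
  refine mem_of_forall_sum_inner_nonneg (x := fun _ => xbar) hA (fun y v hv => ?_) i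
  have hxw : ∀ i, TendstoWeakly (x i) F xbar := fun i => hw.of_sub (hx i)
  -- Products of weakly convergent families need not converge. Splitting x_i = (x_i - w) + w leaves
  -- a strongly null factor against a bounded one, and the common w against the strongly convergent
  -- sum of the a_i.
  have e : ∀ k, ∑ i, ⟪x i k - y i, a i k - v i⟫_ℝ = ∑ i, ⟪a i k, x i k - w k⟫_ℝ
      + ⟪w k, ∑ i, a i k⟫_ℝ - ∑ i, ⟪v i, x i k⟫_ℝ - ∑ i, ⟪y i, a i k⟫_ℝ + ∑ i, ⟪y i, v i⟫_ℝ := by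
    intro k
    rw [inner_sum, ← Finset.sum_add_distrib, ← Finset.sum_sub_distrib, ← Finset.sum_sub_distrib,
      ← Finset.sum_add_distrib]
    refine Finset.sum_congr rfl fun i _ => ?_
    simp only [inner_sub_left, inner_sub_right]
    rw [real_inner_comm (a i k) (x i k), real_inner_comm (a i k) (w k),
      real_inner_comm (x i k) (v i)]
    ring
  have hlim : Tendsto (fun k => ∑ i, ⟪x i k - y i, a i k - v i⟫_ℝ) F
      (𝓝 (∑ i, ⟪abar i, 0⟫_ℝ + ⟪xbar, s⟫_ℝ - ∑ i, ⟪v i, xbar⟫_ℝ - ∑ i, ⟪y i, abar i⟫_ℝ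
        + ∑ i, ⟪y i, v i⟫_ℝ)) := by
    simp only [e]
    exact ((((tendsto_finsetSum _ fun i _ => (ha i).inner (haR i) (hx i)).add
      (hw.inner hwR hs)).sub (tendsto_finsetSum _ fun i _ => hxw i (v i))).sub
      (tendsto_finsetSum _ fun i _ => ha i (y i))).add tendsto_const_nhds
  have h0 := ge_of_tendsto hlim (Eventually.of_forall fun k =>
    Finset.sum_nonneg fun i _ => (hA i).inner_nonneg (hxa i k) (hv i))
  refine h0.trans_eq ?_
  rw [← hsum, inner_sum, ← Finset.sum_add_distrib, ← Finset.sum_sub_distrib,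
    ← Finset.sum_sub_distrib, ← Finset.sum_add_distrib]
  refine Finset.sum_congr rfl fun i _ => ?_
  simp only [inner_sub_left, inner_sub_right, inner_zero_right]
  rw [real_inner_comm xbar (v i)]
  ring

end Demiclosed

/-! ### Calculus of the operators X ⊗ Id. -/

section Kron

variable {H : Type*} [NormedAddCommGroup H] [InnerProductSpace ℝ H] {p q r : ℕ}

@[simp]
theorem kron_apply (X : Matrix (Fin p) (Fin q) ℝ) (x : Power H q) (i : Fin p) :
    kron X x i = ∑ j, X i j • x j := rfl

@[simp]
theorem blockwise_apply {E : Type*} (B : Fin p → E → E) (y : Power E p) (j : Fin p) :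
    blockwise B y j = B j (y j) := rfl

theorem kron_sub (X : Matrix (Fin p) (Fin q) ℝ) (x y : Power H q) :
    kron X (x - y) = kron X x - kron X y := by
  ext i
  simp [smul_sub]

theorem sub_kron (X Y : Matrix (Fin p) (Fin q) ℝ) (x : Power H q) :
    kron (X - Y) x = kron X x - kron Y x := by
  ext i
  simp [sub_smul]

theorem add_kron (X Y : Matrix (Fin p) (Fin q) ℝ) (x : Power H q) :
    kron (X + Y) x = kron X x + kron Y x := by
  ext i
  simp [add_smul, Finset.sum_add_distrib]

theorem smul_kron (c : ℝ) (X : Matrix (Fin p) (Fin q) ℝ) (x : Power H q) :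
    kron (c • X) x = c • kron X x := by
  ext i
  simp [mul_smul, Finset.smul_sum]

theorem mul_kron (X : Matrix (Fin p) (Fin q) ℝ) (Y : Matrix (Fin q) (Fin r) ℝ) (x : Power H r) :
    kron (X * Y) x = kron X (kron Y x) := by
  ext i
  simp only [kron_apply, Matrix.mul_apply, Finset.sum_smul, Finset.smul_sum, mul_smul]
  exact Finset.sum_comm

theorem inner_kron (X : Matrix (Fin p) (Fin q) ℝ) (x : Power H q) (y : Power H p) :
    ⟪y, kron X x⟫_ℝ = ⟪kron X.transpose y, x⟫_ℝ := by
  simp only [PiLp.inner_apply, kron_apply, inner_sum, sum_inner, inner_smul_left, inner_smul_right,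
    Matrix.transpose_apply, RCLike.conj_to_real]
  exact Finset.sum_comm

theorem diagonal_kron_apply (d : Fin p → ℝ) (x : Power H p) (i : Fin p) :
    kron (Matrix.diagonal d) x i = d i • x i := by
  simp [Matrix.diagonal_apply, ite_smul]

theorem kron_const_apply (X : Matrix (Fin p) (Fin q) ℝ) (u : H) (i : Fin p) :
    kron X (WithLp.toLp 2 fun _ => u) i = X.mulVec 1 i • u := by
  simp [Matrix.mulVec, dotProduct, Finset.sum_smul]

theorem sum_kron_apply (X : Matrix (Fin p) (Fin q) ℝ) (x : Power H q) :
    ∑ i, kron X x i = ∑ j, X.transpose.mulVec 1 j • x j := by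
  simp only [kron_apply, Matrix.mulVec, dotProduct, Matrix.transpose_apply, Pi.one_apply, mul_one,
    Finset.sum_smul]
  exact Finset.sum_comm

-- Factoring X = YᵀY turns the form into the squared norm of `kron Y x`.
open scoped MatrixOrder Matrix.Norms.L2Operator in
theorem inner_kron_nonneg {X : Matrix (Fin p) (Fin p) ℝ} (hX : X.PosSemidef) (x : Power H p) :
    0 ≤ ⟪x, kron X x⟫_ℝ := by
  obtain ⟨Y, rfl⟩ := CStarAlgebra.nonneg_iff_eq_star_mul_self.1 (Matrix.nonneg_iff_posSemidef.2 hX)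
  have : star Y = Y.transpose := by
    rw [Matrix.star_eq_conjTranspose, Matrix.conjTranspose_eq_transpose_of_trivial]
  rw [this, mul_kron, inner_kron, Matrix.transpose_transpose]
  exact real_inner_self_nonneg

theorem inner_mul_diagonal_mul_transpose_kron (X : Matrix (Fin p) (Fin q) ℝ) (d : Fin q → ℝ)
    (x : Power H p) : ⟪x, kron (X * Matrix.diagonal d * X.transpose) x⟫_ℝ
      = ∑ j, d j * ‖kron X.transpose x j‖ ^ 2 := by
  rw [mul_kron, mul_kron, inner_kron, PiLp.inner_apply]
  refine Finset.sum_congr rfl fun j _ => ?_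
  rw [diagonal_kron_apply, inner_smul_right, real_inner_self_eq_norm_sq]

end Kron

/-! ### Opial's lemma and the ergodic rate. -/

section Sequences

variable {V : Type*} [NormedAddCommGroup V] [InnerProductSpace ℝ V]

/-- Opial's lemma. -/
theorem exists_tendstoWeakly_of_fejer [CompleteSpace V] {f : ℕ → V} {R : ℝ} (hR : ∀ k, ‖f k‖ ≤ R)
    {Ω : Set V} (hΩ : ∀ p ∈ Ω, ∃ c, Tendsto (fun k => ‖f k - p‖) atTop (𝓝 c))
    (hcl : ∀ U : Ultrafilter ℕ, ↑U ≤ (atTop : Filter ℕ) → ∀ v, TendstoWeakly f U v → v ∈ Ω) :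
    ∃ v ∈ Ω, TendstoWeakly f atTop v := by
  have huniq : ∀ U U' : Ultrafilter ℕ, ↑U ≤ (atTop : Filter ℕ) → ↑U' ≤ (atTop : Filter ℕ) →
      ∀ v v', TendstoWeakly f U v → TendstoWeakly f U' v' → v = v' := by
    intro U U' hU hU' v v' hv hv'
    obtain ⟨c, hc⟩ := hΩ v (hcl U hU v hv)
    obtain ⟨c', hc'⟩ := hΩ v' (hcl U' hU' v' hv')
    -- This inner product depends only on the distances to v and v', so it converges along the whole
    -- sequence and takes the same limit along both ultrafilters.
    have e : ∀ k, ⟪v - v', f k⟫_ℝ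
        = (‖f k - v'‖ ^ 2 - ‖f k - v‖ ^ 2 + ‖v‖ ^ 2 - ‖v'‖ ^ 2) / 2 := by
      intro k
      rw [norm_sub_sq_real, norm_sub_sq_real, inner_sub_left, real_inner_comm (f k) v,
        real_inner_comm (f k) v']
      ring
    have hlim : Tendsto (fun k => ⟪v - v', f k⟫_ℝ) atTop
        (𝓝 ((c' ^ 2 - c ^ 2 + ‖v‖ ^ 2 - ‖v'‖ ^ 2) / 2)) := by
      simp only [e]
      exact ((((hc'.pow 2).sub (hc.pow 2)).add_const _).sub_const _).div_const 2
    have h1 := tendsto_nhds_unique (hlim.mono_left hU) (hv _)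
    have h2 := tendsto_nhds_unique (hlim.mono_left hU') (hv' _)
    have h3 : ⟪v - v', v - v'⟫_ℝ = 0 := by rw [inner_sub_right, ← h1, ← h2, sub_self]
    exact sub_eq_zero.1 (inner_self_eq_zero.1 h3)
  obtain ⟨v, hv⟩ := exists_tendstoWeakly (Ultrafilter.of (atTop : Filter ℕ)) hR
  refine ⟨v, hcl _ (Ultrafilter.of_le _) v hv, fun y => ?_⟩
  refine (tendsto_iff_ultrafilter _ _ _).2 fun U hU => ?_
  obtain ⟨v', hv'⟩ := exists_tendstoWeakly U hR
  rw [huniq _ U (Ultrafilter.of_le _) hU v v' hv hv']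
  exact hv' y

/-- By Cauchy–Schwarz the squared norm of the sum is at most (k + 1) times the total of the series.
-/
theorem isBigO_norm_average {v : ℕ → V} (hv : Summable fun k => ‖v k‖ ^ 2) :
    (fun k : ℕ => ‖(1 / ((k : ℝ) + 1)) • ∑ s ∈ Finset.range (k + 1), v s‖)
      =O[atTop] (fun k : ℕ => 1 / √(k : ℝ)) := by
  set c := ∑' k, ‖v k‖ ^ 2 with hc
  refine IsBigO.of_bound (√c) ?_
  filter_upwards [eventually_gt_atTop 0] with k hk
  have hk' : (0 : ℝ) < k := Nat.cast_pos.2 hk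
  have h1 : ‖∑ s ∈ Finset.range (k + 1), v s‖ ≤ √((k + 1) * c) := by
    refine Real.le_sqrt_of_sq_le ?_
    calc ‖∑ s ∈ Finset.range (k + 1), v s‖ ^ 2
        ≤ (∑ s ∈ Finset.range (k + 1), ‖v s‖) ^ 2 := by gcongr; exact norm_sum_le _ _
      _ ≤ (Finset.range (k + 1)).card * ∑ s ∈ Finset.range (k + 1), ‖v s‖ ^ 2 :=
        sq_sum_le_card_mul_sum_sq
      _ ≤ (k + 1) * c := by
        rw [Finset.card_range]
        push_cast
        gcongr
        exact hv.sum_le_tsum _ fun _ _ => sq_nonneg _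
  have h2 : √((k : ℝ) + 1) * √((k : ℝ) + 1) = k + 1 := Real.mul_self_sqrt (by positivity)
  have h3 : √(k : ℝ) ≤ √((k : ℝ) + 1) := Real.sqrt_le_sqrt (by linarith)
  have h4 : 0 < √(k : ℝ) := Real.sqrt_pos.2 hk'
  rw [norm_norm, norm_smul, Real.norm_of_nonneg (by positivity), Real.norm_of_nonneg (by positivity),
    one_div_mul_eq_div, mul_one_div, div_le_div_iff₀ (by positivity) h4]
  rw [Real.sqrt_mul (by positivity)] at h1
  calc ‖∑ s ∈ Finset.range (k + 1), v s‖ * √(k : ℝ)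
      ≤ (√((k : ℝ) + 1) * √c) * √((k : ℝ) + 1) := by gcongr
    _ = √c * (k + 1) := by rw [mul_right_comm, h2, mul_comm]

end Sequences

/-! ### Bounded families. -/

section NormBounded

variable {V : Type*} [NormedAddCommGroup V] {ι : Type*} {f g : ι → V}

/-- A family of vectors is bounded in norm. -/
def NormBounded (f : ι → V) : Prop := ∃ R, ∀ k, ‖f k‖ ≤ R

theorem NormBounded.add (hf : NormBounded f) (hg : NormBounded g) :
    NormBounded fun k => f k + g k := by
  obtain ⟨R, hR⟩ := hf
  obtain ⟨R', hR'⟩ := hg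
  exact ⟨R + R', fun k => norm_add_le_of_le (hR k) (hR' k)⟩

theorem NormBounded.sub (hf : NormBounded f) (hg : NormBounded g) :
    NormBounded fun k => f k - g k := by
  obtain ⟨R, hR⟩ := hf
  obtain ⟨R', hR'⟩ := hg
  exact ⟨R + R', fun k => norm_sub_le_of_le (hR k) (hR' k)⟩

theorem NormBounded.of_tendsto {f : ℕ → V} {v : V} (hf : Tendsto f atTop (𝓝 v)) :
    NormBounded f := by
  obtain ⟨R, hR⟩ := (Metric.isBounded_range_of_tendsto f hf).exists_norm_le
  exact ⟨R, fun k => hR _ ⟨k, rfl⟩⟩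

theorem NormBounded.comp_lipschitz {W : Type*} [NormedAddCommGroup W] (hf : NormBounded f) {c : NNReal} {B : V → W} (hB : LipschitzWith c B) :
    NormBounded fun k => B (f k) := by
  obtain ⟨R, hR⟩ := hf
  refine ⟨c * R + ‖B 0‖, fun k => ?_⟩
  have h1 := hB.norm_sub_le (f k) 0
  rw [sub_zero] at h1
  have h2 := norm_le_norm_add_norm_sub' (B (f k)) (B 0)
  have h3 := mul_le_mul_of_nonneg_left (hR k) c.2
  rw [NNReal.val_eq_coe] at h3
  linarith

theorem NormBounded.kron_apply {H : Type*} [NormedAddCommGroup H] [InnerProductSpace ℝ H]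
    {p q : ℕ} {f : ι → Power H q} (hf : ∀ j, NormBounded fun k => f k j)
    (X : Matrix (Fin p) (Fin q) ℝ) (i : Fin p) : NormBounded fun k => kron X (f k) i := by
  choose R hR using hf
  refine ⟨∑ j, ‖X i j‖ * R j, fun k => ?_⟩
  simp only [Splitting.kron_apply]
  refine norm_sum_le_of_le _ fun j _ => ?_
  rw [norm_smul]
  exact mul_le_mul_of_nonneg_left (hR j k) (norm_nonneg _)

theorem NormBounded.apply {H : Type*} [NormedAddCommGroup H] [InnerProductSpace ℝ H]
    {q : ℕ} {f : ι → Power H q} (hf : NormBounded f) (j : Fin q) : NormBounded fun k => f k j := by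
  obtain ⟨R, hR⟩ := hf
  exact ⟨R, fun k => (PiLp.norm_apply_le _ _).trans (hR k)⟩

end NormBounded

/-! ### Consequences of the assumptions on the matrices. -/

section Coefficients

variable {n m l : ℕ} {S : Coeffs n m l} {σ : Fin m → ℝ} {L : Fin l → ℝ}

/-- Each composition is strictly lower triangular: a column active in row i of the left factor lies
below the staircase there, and by monotonicity the right factor vanishes on it in all rows h ≥ i.
For P - Q this needs F_i ≤ E_h, which follows from F_i ≤ E_{i-1}. -/
theorem Coeffs.Admissible.triangular (hS : S.Admissible σ L) :
    (∀ i h j, i ≤ h → S.H i j = 0 ∨ S.G.transpose h j = 0) ∧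
    (∀ i h j, i ≤ h → (S.P - S.Q) i j = 0 ∨ S.R.transpose h j = 0) ∧
    (∀ i h j, i ≤ h → S.Q i j = 0 ∨ S.P h j = 0) := by
  obtain ⟨E, ⟨-, -, hE⟩, hH, hG⟩ := hS.causal
  obtain ⟨E', F, ⟨h0, -, hE'⟩, ⟨hF0, -, hF⟩, hEF, hQ, hR, hPF, hPE⟩ := hS.relativelyCausal
  have hFE : ∀ i h : Fin n, i ≤ h → F i ≤ E' h := by
    intro i h hih
    rcases Nat.eq_zero_or_pos i.val with hi | hi
    · rw [hF0 i hi]; exact Nat.zero_le _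
    · exact (hEF ⟨i.val - 1, by omega⟩ i (by simp; omega)).trans
        (hE' (Fin.le_def.mpr (by have := Fin.le_def.mp hih; simp; omega)))
  refine ⟨fun i h j hih => ?_, fun i h j hih => ?_, fun i h j hih => ?_⟩
  · rcases lt_or_ge (E i) (j.val + 1) with hj | hj
    · exact Or.inl (hH i j hj)
    · exact Or.inr (hG h j (hj.trans (hE hih)))
  · rcases lt_or_ge (E' h) (j.val + 1) with hj | hj
    · refine Or.inl ?_
      rw [Matrix.sub_apply, hPE i j ((hE' hih).trans_lt hj),
        hQ i j ((hFE i h hih).trans_lt hj), sub_zero]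
    · exact Or.inr (hR h j hj)
  · rcases lt_or_ge (F i) (j.val + 1) with hj | hj
    · exact Or.inl (hQ i j hj)
    · exact Or.inr (hPF h j (hj.trans (hF hih)))

theorem Coeffs.Admissible.first_row (hS : S.Admissible σ L) {i : Fin n} (hi : i.val = 0) :
    (∀ j, S.H i j = 0) ∧ (∀ j, (S.P - S.Q) i j = 0) ∧ ∀ j, S.Q i j = 0 := by
  obtain ⟨E, ⟨hE0, -, -⟩, hH, -⟩ := hS.causal
  obtain ⟨E', F, ⟨hE'0, -, -⟩, ⟨hF0, -, -⟩, -, hQ, -, -, hP⟩ := hS.relativelyCausal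
  have hQ0 : ∀ j, S.Q i j = 0 := fun j => hQ i j (by rw [hF0 i hi]; omega)
  refine ⟨fun j => hH i j (by rw [hE0 i hi]; omega), fun j => ?_, hQ0⟩
  rw [Matrix.sub_apply, hQ0, hP i j (by rw [hE'0 i hi]; omega), sub_zero]

/-- Assumption (c) tested on y: each subtracted matrix has the form X diag(d) Xᵀ and contributes a
weighted sum of squares. -/
theorem Coeffs.Admissible.norm_sq_add_le (hS : S.Admissible σ L) (hσ : ∀ j, 0 < σ j)
    {H : Type*} [NormedAddCommGroup H] [InnerProductSpace ℝ H] (y : Power H n) :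
    ‖kron S.M.transpose y‖ ^ 2 + ∑ j, (σ j)⁻¹ / 2 * ‖kron S.H.transpose y j - kron S.G y j‖ ^ 2
      + ∑ j, L j * ‖kron S.P.transpose y j - kron S.Q.transpose y j‖ ^ 2
      + ∑ j, L j * ‖kron S.P.transpose y j - kron S.R y j‖ ^ 2 ≤ ⟪y, kron S.K y⟫_ℝ := by
  have hinv : (Matrix.diagonal σ)⁻¹ = Matrix.diagonal fun j => (σ j)⁻¹ := by
    refine Matrix.inv_eq_right_inv ?_
    rw [Matrix.diagonal_mul_diagonal, ← Matrix.diagonal_one]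
    congr 1
    ext j
    exact mul_inv_cancel₀ (hσ j).ne'
  have h := inner_kron_nonneg hS.K_posSemidef y
  have e1 : S.H.transpose - S.G = (S.H - S.G.transpose).transpose := by
    rw [Matrix.transpose_sub, Matrix.transpose_transpose]
  have e2 : S.P.transpose - S.R = (S.P - S.R.transpose).transpose := by
    rw [Matrix.transpose_sub, Matrix.transpose_transpose]
  have e3 : S.P.transpose - S.Q.transpose = (S.P - S.Q).transpose := by
    rw [Matrix.transpose_sub]
  rw [hinv, e1, e2, e3, sub_kron, sub_kron, sub_kron, sub_kron, inner_sub_right, inner_sub_right,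
    inner_sub_right, inner_sub_right, smul_kron, inner_smul_right,
    inner_mul_diagonal_mul_transpose_kron, inner_mul_diagonal_mul_transpose_kron,
    inner_mul_diagonal_mul_transpose_kron, ← e1, ← e2, ← e3, mul_kron, inner_kron S.M,
    real_inner_self_eq_norm_sq, Finset.mul_sum] at h
  simp only [sub_kron, PiLp.sub_apply] at h
  have e4 : ∀ j, (σ j)⁻¹ / 2 * ‖kron S.H.transpose y j - kron S.G y j‖ ^ 2
      = 1 / 2 * ((σ j)⁻¹ * ‖kron S.H.transpose y j - kron S.G y j‖ ^ 2) := fun j => by ring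
  simp only [e4]
  linarith

theorem Coeffs.Admissible.norm_sq_le (hS : S.Admissible σ L) (hσ : ∀ j, 0 < σ j)
    (hL : ∀ j, 0 < L j) {H : Type*} [NormedAddCommGroup H] [InnerProductSpace ℝ H]
    (y : Power H n) : ‖kron S.M.transpose y‖ ^ 2 ≤ ⟪y, kron S.K y⟫_ℝ := by
  have h := hS.norm_sq_add_le hσ y
  have h1 : 0 ≤ ∑ j, (σ j)⁻¹ / 2 * ‖kron S.H.transpose y j - kron S.G y j‖ ^ 2 :=
    Finset.sum_nonneg fun j _ => by have := hσ j; positivity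
  have h2 : 0 ≤ ∑ j, L j * ‖kron S.P.transpose y j - kron S.Q.transpose y j‖ ^ 2 :=
    Finset.sum_nonneg fun j _ => by have := hL j; positivity
  have h3 : 0 ≤ ∑ j, L j * ‖kron S.P.transpose y j - kron S.R y j‖ ^ 2 :=
    Finset.sum_nonneg fun j _ => by have := hL j; positivity
  linarith

/-- Test (c) on the all-ones vector, where the form of K vanishes. -/
theorem Coeffs.Admissible.M_sum (hS : S.Admissible σ L) (hσ : ∀ j, 0 < σ j)
    (hL : ∀ j, 0 < L j) : S.M.transpose.mulVec 1 = 0 := by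
  have h := hS.norm_sq_le hσ hL (WithLp.toLp 2 fun _ => (1 : ℝ))
  have e : ⟪(WithLp.toLp 2 fun _ => (1 : ℝ) : Power ℝ n), kron S.K (WithLp.toLp 2 fun _ => (1 : ℝ))⟫_ℝ
      = 0 := by
    rw [← hS.K_sum, PiLp.inner_apply]
    exact Finset.sum_congr rfl fun i _ => by rw [kron_const_apply]; simp
  rw [e] at h
  have h0 : kron S.M.transpose (WithLp.toLp 2 fun _ => (1 : ℝ)) = 0 :=
    norm_eq_zero.1 (pow_eq_zero_iff two_ne_zero |>.1 (h.antisymm (sq_nonneg _)))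
  ext j
  have := congrArg (fun w : Power ℝ (n - 1) => w j) h0
  simpa only [kron_const_apply, smul_eq_mul, mul_one, PiLp.zero_apply, Pi.zero_apply] using this

/-- Test (c) on a unit vector: if K_ii were 0, that vector would lie in ker Mᵀ, hence be constant,
which n ≥ 2 excludes. This makes the step sizes positive. -/
theorem Coeffs.Admissible.K_pos (hS : S.Admissible σ L) (hσ : ∀ j, 0 < σ j) (hL : ∀ j, 0 < L j)
    (hn : 2 ≤ n) (i : Fin n) : 0 < S.K i i := by
  have h := hS.norm_sq_le hσ hL (PiLp.single 2 i (1 : ℝ) : Power ℝ n)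
  have hk : ∀ {p : ℕ} (X : Matrix (Fin p) (Fin n) ℝ) (j : Fin p),
      kron X (PiLp.single 2 i (1 : ℝ) : Power ℝ n) j = X j i := by
    intro p X j
    rw [kron_apply, Finset.sum_eq_single i] <;> simp +contextual
  have e : ⟪(PiLp.single 2 i (1 : ℝ) : Power ℝ n), kron S.K (PiLp.single 2 i (1 : ℝ))⟫_ℝ
      = S.K i i := by
    rw [PiLp.inner_apply, Finset.sum_eq_single i]
    · rw [hk]; simp
    · intro j _ hj
      simp [hj]
    · simp
  rw [e] at h
  refine lt_of_le_of_ne ((sq_nonneg _).trans h) fun h0 => ?_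
  rw [← h0] at h
  have hz : kron S.M.transpose (PiLp.single 2 i (1 : ℝ) : Power ℝ n) = 0 :=
    norm_eq_zero.1 (pow_eq_zero_iff two_ne_zero |>.1 (h.antisymm (sq_nonneg _)))
  have hker : (Pi.single i 1 : Fin n → ℝ) ∈ LinearMap.ker S.M.transpose.mulVecLin := by
    rw [LinearMap.mem_ker, Matrix.mulVecLin_apply, Matrix.mulVec_single_one]
    ext j
    have := congrArg (fun w : Power ℝ (n - 1) => w j) hz
    rw [hk] at this
    exact this
  obtain ⟨c, hc⟩ := Submodule.mem_span_singleton.1 (hS.ker_le hker)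
  have : Nontrivial (Fin n) := Fin.nontrivial_iff_two_le.2 hn
  obtain ⟨j, hj⟩ := exists_ne i
  have h1 := congrFun hc i
  have h2 := congrFun hc j
  simp only [Pi.smul_apply, Pi.one_apply, smul_eq_mul, mul_one, Pi.single_eq_same,
    Pi.single_eq_of_ne hj] at h1 h2
  linarith

/-- The range of M is the annihilator of ker Mᵀ, and that kernel contains only constant vectors. -/
theorem Coeffs.Admissible.exists_mulVec_eq (hS : S.Admissible σ L) {t : Fin n → ℝ}
    (ht : ∑ i, t i = 0) : ∃ s, S.M.mulVec s = t := by
  by_contra h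
  have ht' : t ∉ LinearMap.range S.M.mulVecLin := fun ⟨s, hs⟩ => h ⟨s, hs⟩
  obtain ⟨f, hft, hf⟩ := Submodule.exists_dual_map_eq_bot_of_notMem ht' inferInstance
  set u : Fin n → ℝ := fun i => f (Pi.single i 1) with hu
  have hfu : ∀ v, f v = v ⬝ᵥ u := by
    intro v
    rw [LinearMap.pi_apply_eq_sum_univ f v]
    refine Finset.sum_congr rfl fun i _ => ?_
    rw [smul_eq_mul, hu]
    congr 2
    ext j
    simp [Pi.single_apply, eq_comm]
  have hker : u ∈ LinearMap.ker S.M.transpose.mulVecLin := by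
    rw [LinearMap.mem_ker, Matrix.mulVecLin_apply]
    refine dotProduct_eq_zero _ fun w => ?_
    rw [Matrix.mulVec_transpose, ← Matrix.dotProduct_mulVec, dotProduct_comm, ← hfu]
    have : f (S.M.mulVec w) ∈ (LinearMap.range S.M.mulVecLin).map f :=
      Submodule.mem_map_of_mem ⟨w, rfl⟩
    rwa [hf, Submodule.mem_bot] at this
  obtain ⟨c, hc⟩ := Submodule.mem_span_singleton.1 (hS.ker_le hker)
  apply hft
  rw [hfu, ← hc, dotProduct_smul, dotProduct_one, ht, smul_zero]

theorem Coeffs.Admissible.exists_kron_eq (hS : S.Admissible σ L) {H : Type*}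
    [NormedAddCommGroup H] [InnerProductSpace ℝ H] (hn : 0 < n) {w : Power H n}
    (hw : ∑ i, w i = 0) : ∃ v, kron S.M v = w := by
  -- Preimages of e_h - e_0 suffice, since w is the sum of the w_h ⊗ (e_h - e_0) when its entries
  -- sum to 0.
  have hex : ∀ h : Fin n, ∃ s, S.M.mulVec s
      = fun i => (if i = h then (1 : ℝ) else 0) - if i = ⟨0, hn⟩ then 1 else 0 := fun h =>
    hS.exists_mulVec_eq (by simp)
  choose s hs using hex
  refine ⟨kron (Matrix.of fun j h => s h j) w, ?_⟩
  ext i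
  have e : ∀ h, (S.M * Matrix.of fun j h => s h j) i h
      = (if i = h then (1 : ℝ) else 0) - if i = ⟨0, hn⟩ then 1 else 0 := fun h => congrFun (hs h) i
  rw [← mul_kron, kron_apply]
  simp only [e, sub_smul, Finset.sum_sub_distrib, ← Finset.smul_sum, hw, smul_zero, sub_zero]
  simp only [ite_smul, one_smul, zero_smul, Finset.sum_ite_eq, Finset.mem_univ, if_true]

/-- Minus the lower triangular part of `K`, with halved diagonal. -/
noncomputable def Coeffs.lower (S : Coeffs n m l) : Matrix (Fin n) (Fin n) ℝ :=
  S.N - Matrix.diagonal fun i => S.K i i / 2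

theorem Coeffs.lower_add_transpose (hK : S.K.IsSymm) : S.lower + S.lower.transpose = -S.K := by
  ext i j
  have := hK.apply i j
  simp only [lower, N, Matrix.add_apply, Matrix.sub_apply, Matrix.of_apply, Matrix.transpose_apply,
    Matrix.diagonal_apply, Matrix.neg_apply]
  rcases lt_trichotomy i j with h | h | h
  · simp [h, h.not_gt, h.ne, h.ne', this]
  · subst h
    simp
    ring
  · simp [h, h.not_gt, h.ne, h.ne']

theorem Coeffs.inner_lower_kron (hK : S.K.IsSymm) {H : Type*} [NormedAddCommGroup H]
    [InnerProductSpace ℝ H] (y : Power H n) :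
    ⟪y, kron S.lower y⟫_ℝ = -(⟪y, kron S.K y⟫_ℝ / 2) := by
  have h : ⟪y, kron (S.lower + S.lower.transpose) y⟫_ℝ = ⟪y, kron (-1 • S.K) y⟫_ℝ := by
    rw [lower_add_transpose hK, neg_one_smul]
  have e : kron (-1 • S.K) y = (-1 : ℝ) • kron S.K y := by
    rw [← smul_kron]; norm_num
  rw [e, add_kron, inner_add_right, inner_smul_right, inner_kron S.lower.transpose,
    Matrix.transpose_transpose, real_inner_comm] at h
  rw [real_inner_comm]
  linarith

theorem Coeffs.Admissible.sum_lower (hS : S.Admissible σ L) :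
    ∑ j, S.lower.transpose.mulVec 1 j = 0 := by
  have h : (1 : Fin n → ℝ) ⬝ᵥ (S.lower + S.lower.transpose).mulVec 1 = 0 := by
    rw [lower_add_transpose hS.K_symm, Matrix.neg_mulVec, dotProduct_neg, hS.K_sum, neg_zero]
  rw [Matrix.add_mulVec, dotProduct_add, Matrix.dotProduct_mulVec, ← Matrix.mulVec_transpose,
    dotProduct_one, one_dotProduct] at h
  linarith

end Coefficients

/-! ### The stage equation as an inclusion, and its equal-stage solutions. -/

section Stage

variable {H : Type*} [NormedAddCommGroup H] [InnerProductSpace ℝ H] {n m l : ℕ}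
  {S : Coeffs n m l} {σ : Fin m → ℝ} {L : Fin l → ℝ}
  {A : Fin n → H → Set H} {B : Fin m → H → H} {C : Fin l → H → H}

/-- The constant family `(u, …, u) ∈ H^n`. -/
def constPower (n : ℕ) (u : H) : Power H n := WithLp.toLp 2 fun _ => u

/-- The elements `a_i ∈ A_i(x_i)` that the stage equation singles out, as a function of `z`, `x`
and of the values `b`, `c`, `e` of the single-valued operators at `G x`, `R x` and `P* x`. -/
noncomputable def Coeffs.selectionOf (S : Coeffs n m l) (z : Power H (n - 1)) (x : Power H n)
    (b : Power H m) (c e : Power H l) : Power H n :=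
  kron S.lower x + kron S.M z - kron S.H b - kron (S.P - S.Q) c - kron S.Q e

/-- The elements `a_i ∈ A_i(x_i)` that the stage equation singles out. -/
noncomputable def Coeffs.selection (S : Coeffs n m l) (B : Fin m → H → H) (C : Fin l → H → H)
    (z : Power H (n - 1)) (x : Power H n) : Power H n :=
  S.selectionOf z x (blockwise B (kron S.G x)) (blockwise C (kron S.R x))
    (blockwise C (kron S.P.transpose x))

/-- Because d_i K_ii / 2 = 1, the half diagonal subtracted in `lower` is compensated by the extra
summand x_i. A fixed point thus has the form x_i = J(x_i + d_i a_i). -/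
theorem Coeffs.stageMap_apply (hK : ∀ i, 0 < S.K i i) (z : Power H (n - 1)) (x : Power H n)
    (i : Fin n) : S.stageMap A B C z x i
      = resolvent (S.d i) (A i) (x i + S.d i • S.selection B C z x i) := by
  have hd : S.d i * (S.K i i / 2) = 1 := by
    have := (hK i).ne'
    rw [d]
    field_simp
  have e : x i + S.d i • S.selection B C z x i
      = S.d i • (S.selection B C z x i + kron (Matrix.diagonal fun i => S.K i i / 2) x i) := by
    rw [diagonal_kron_apply, smul_add, smul_smul, hd, one_smul, add_comm]
  rw [e]
  simp only [stageMap, diagonal_kron_apply]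
  congr 2
  simp only [selection, selectionOf, lower, sub_kron, diagonal_kron_apply, PiLp.sub_apply,
    PiLp.add_apply]
  abel

theorem Coeffs.eq_stageMap_iff [CompleteSpace H] (hA : ∀ i, MaximallyMonotone (A i))
    (hK : ∀ i, 0 < S.K i i) {z : Power H (n - 1)} {x : Power H n} :
    x = S.stageMap A B C z x ↔ ∀ i, S.selection B C z x i ∈ A i (x i) := by
  have hd : ∀ i, 0 < S.d i := fun i => div_pos two_pos (hK i)
  constructor
  · intro h i
    have hi : x i = resolvent (S.d i) (A i) (x i + S.d i • S.selection B C z x i) := by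
      rw [← stageMap_apply hK, ← h]
    obtain ⟨a, ha, hax⟩ := (hA i).resolvent_spec (hd i) (x i + S.d i • S.selection B C z x i)
    rw [← hi] at ha hax
    rwa [← smul_right_injective H (hd i).ne' (add_left_cancel hax)]
  · intro h
    ext i
    rw [stageMap_apply hK, (hA i).resolvent_eq (hd i) (h i)]

theorem Coeffs.Admissible.stagePoint_eq (hS : S.Admissible σ L) {z : Power H (n - 1)}
    {x : Power H n} (hx : x = S.stageMap A B C z x) : S.stagePoint A B C z = x := by
  have h : S.stagePoint A B C z = S.stageMap A B C z (S.stagePoint A B C z) :=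
    Classical.epsilon_spec (p := fun x => x = S.stageMap A B C z x) ⟨x, hx⟩
  exact (Coeffs.existsUnique_stagePoint hS A B C z).unique h hx

theorem Coeffs.Admissible.stageMap_first (hS : S.Admissible σ L) {i : Fin n} (hi : i.val = 0)
    (z : Power H (n - 1)) (x : Power H n) :
    S.stageMap A B C z x i = resolvent (S.d i) (A i) (S.d i • ∑ j, S.M i j • z j) := by
  obtain ⟨h1, h2, h3⟩ := hS.first_row hi
  have hN : ∀ j, S.N i j = 0 := fun j => by
    have : ¬ j < i := by rw [Fin.lt_def]; omega
    simp [N, this]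
  simp only [stageMap, diagonal_kron_apply, PiLp.sub_apply, PiLp.add_apply]
  simp only [kron_apply, h1, h2, h3, hN, zero_smul, Finset.sum_const_zero, zero_add, sub_zero]

/-- The vector which agrees with `x` before position `i` and vanishes from there on. -/
noncomputable def truncate (i : Fin n) (x : Power H n) : Power H n :=
  WithLp.toLp 2 fun h => if h < i then x h else 0

theorem kron_truncate_apply {p : ℕ} (X : Matrix (Fin p) (Fin n) ℝ) (i : Fin n) (x : Power H n)
    (j : Fin p) : kron X (truncate i x) j = ∑ h ∈ Finset.Iio i, X j h • x h := by
  have e : Finset.Iio i = Finset.univ.filter (· < i) := by ext; simp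
  rw [e, Finset.sum_filter]
  simp [truncate, smul_ite]

/-- The algorithm evaluates B and C at sums cut off before i. This changes only those values whose
coefficient in row i is zero. -/
theorem Coeffs.Generates.eq_stageMap (hS : S.Admissible σ L) {γ : ℕ → ℝ}
    {z : ℕ → Power H (n - 1)} {x : ℕ → Power H n} (h : S.Generates A B C γ z x) (k : ℕ) :
    x k = S.stageMap A B C (z k) (x k) := by
  obtain ⟨c1, c2, c3⟩ := hS.triangular
  ext i
  have ht : ∀ h < i, x k h = truncate i (x k) h := fun h hh => by simp [truncate, hh]
  have hk : ∀ {p : ℕ} (X : Matrix (Fin n) (Fin p) ℝ) (Y : Matrix (Fin p) (Fin n) ℝ)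
      (D : Fin p → H → H), kron X (blockwise D (kron Y (truncate i (x k)))) i
        = ∑ j, X i j • D j (∑ h ∈ Finset.Iio i, Y j h • x k h) := fun X Y D => by
    simp only [kron_apply X, blockwise_apply, kron_truncate_apply]
  have e1 := causal_apply c1 B ht
  have e2 := causal_apply c2 C ht
  have e3 := causal_apply c3 C ht
  rw [Matrix.transpose_transpose, hk] at e1 e2
  rw [hk] at e3
  have e0 : kron S.N (x k) i = -∑ j ∈ Finset.Iio i, S.K i j • x k j := by
    have e : Finset.Iio i = Finset.univ.filter (· < i) := by ext; simp
    rw [e, Finset.sum_filter, ← Finset.sum_neg_distrib, kron_apply]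
    refine Finset.sum_congr rfl fun j _ => ?_
    by_cases hj : j < i <;> simp [N, hj]
  rw [h.x_eq k i]
  simp only [stageMap, diagonal_kron_apply, PiLp.sub_apply, PiLp.add_apply, e0, e1, e2, e3]
  simp only [kron_apply, smul_sub, smul_add, smul_neg, Matrix.sub_apply, Matrix.transpose_apply]

/-- Column sums: those of H and Q are 1, those of M and P - Q are 0, so both z and c drop out. -/
theorem Coeffs.Admissible.sum_selectionOf (hS : S.Admissible σ L) (hσ : ∀ j, 0 < σ j)
    (hL : ∀ j, 0 < L j) (z : Power H (n - 1)) (x : Power H n) (b : Power H m) (c e : Power H l) :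
    ∑ i, S.selectionOf z x b c e i + ∑ j, b j + ∑ j, e j
      = ∑ j, S.lower.transpose.mulVec 1 j • x j := by
  simp only [selectionOf, PiLp.sub_apply, PiLp.add_apply, Finset.sum_sub_distrib,
    Finset.sum_add_distrib, sum_kron_apply, Matrix.transpose_sub, Matrix.sub_mulVec, hS.H_sum,
    hS.P_sum, hS.Q_sum, hS.M_sum hσ hL, Pi.one_apply, one_smul, Pi.zero_apply, zero_smul, sub_self,
    Finset.sum_const_zero]
  abel

theorem Coeffs.selection_const (hS : S.Admissible σ L) (z : Power H (n - 1)) (u : H) :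
    S.selection B C z (constPower n u) = S.selectionOf z (constPower n u)
      (WithLp.toLp 2 fun j => B j u) (WithLp.toLp 2 fun j => C j u)
      (WithLp.toLp 2 fun j => C j u) := by
  have h1 : blockwise B (kron S.G (constPower n u)) = WithLp.toLp 2 fun j => B j u := by
    ext j
    simp only [constPower, blockwise_apply, kron_const_apply, hS.G_sum, Pi.one_apply, one_smul]
  have h2 : blockwise C (kron S.R (constPower n u)) = WithLp.toLp 2 fun j => C j u := by
    ext j
    simp only [constPower, blockwise_apply, kron_const_apply, hS.R_sum, Pi.one_apply, one_smul]
  have h3 : blockwise C (kron S.P.transpose (constPower n u)) = WithLp.toLp 2 fun j => C j u := by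
    ext j
    simp only [constPower, blockwise_apply, kron_const_apply, hS.P_sum, Pi.one_apply, one_smul]
  rw [selection, h1, h2, h3]

theorem mem_zerosOfSum_of_selection (hS : S.Admissible σ L) (hσ : ∀ j, 0 < σ j)
    (hL : ∀ j, 0 < L j) {z : Power H (n - 1)} {u : H}
    (h : ∀ i, S.selection B C z (constPower n u) i ∈ A i u) : u ∈ zerosOfSum A B C := by
  refine ⟨fun i => S.selection B C z (constPower n u) i, h, ?_⟩
  have := hS.sum_selectionOf hσ hL z (constPower n u)
    (WithLp.toLp 2 fun j => B j u) (WithLp.toLp 2 fun j => C j u) (WithLp.toLp 2 fun j => C j u)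
  rw [← Coeffs.selection_const hS] at this
  refine this.trans ?_
  simp only [constPower]
  rw [← Finset.sum_smul, hS.sum_lower, zero_smul]

theorem exists_selection_of_mem_zerosOfSum (hS : S.Admissible σ L) (hσ : ∀ j, 0 < σ j)
    (hL : ∀ j, 0 < L j) (hn : 0 < n) {u : H} (hu : u ∈ zerosOfSum A B C) :
    ∃ z, ∀ i, S.selection B C z (constPower n u) i ∈ A i u := by
  obtain ⟨a, ha, hsum⟩ := hu
  have h0 := hS.sum_selectionOf hσ hL 0 (constPower n u)
    (WithLp.toLp 2 fun j => B j u) (WithLp.toLp 2 fun j => C j u) (WithLp.toLp 2 fun j => C j u)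
  rw [← Coeffs.selection_const hS] at h0
  have h1 : ∑ j, S.lower.transpose.mulVec 1 j • constPower n u j = 0 := by
    simp only [constPower]
    rw [← Finset.sum_smul, hS.sum_lower, zero_smul]
  rw [h1] at h0
  -- The defect at z = 0 has zero sum, so it lies in the range of M and a suitable z corrects it.
  have h2 : ∑ i, (WithLp.toLp 2 a - S.selection B C 0 (constPower n u)) i = 0 := by
    simp only [PiLp.sub_apply, Finset.sum_sub_distrib]
    have h3 := hsum.trans h0.symm
    rw [sub_eq_zero]
    exact add_right_cancel (add_right_cancel h3)
  obtain ⟨z, hz⟩ := hS.exists_kron_eq hn h2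
  refine ⟨z, fun i => ?_⟩
  have e : S.selection B C z (constPower n u)
      = S.selection B C 0 (constPower n u) + kron S.M z := by
    have : kron S.M (0 : Power H (n - 1)) = 0 := by ext; simp
    simp only [Coeffs.selection, Coeffs.selectionOf, this]
    abel
  rw [e, hz, add_sub_cancel]
  exact ha i

/-- Completing the square: the cocoercive term s‖b‖² absorbs the cross term ‖h - g‖‖b‖. -/
theorem neg_inner_le_of_cocoercive {s : ℝ} (hs : 0 < s) {b g h : H} (hb : s * ‖b‖ ^ 2 ≤ ⟪b, g⟫_ℝ) :
    -⟪h, b⟫_ℝ ≤ s⁻¹ / 4 * ‖h - g‖ ^ 2 := by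
  have h1 : -⟪h, b⟫_ℝ = -⟪b, g⟫_ℝ - ⟪h - g, b⟫_ℝ := by
    rw [inner_sub_left, real_inner_comm b g]; ring
  have h2 := neg_le_of_abs_le (abs_real_inner_le_norm (h - g) b)
  have h3 : s⁻¹ / 4 * ‖h - g‖ ^ 2 - ‖h - g‖ * ‖b‖ + s * ‖b‖ ^ 2
      = s * (‖b‖ - s⁻¹ / 2 * ‖h - g‖) ^ 2 := by
    field_simp
    ring
  have h4 : 0 ≤ s * (‖b‖ - s⁻¹ / 2 * ‖h - g‖) ^ 2 := by positivity
  linarith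

/-- Used with p, q, r the entries of P*y, Q*y, Ry. Monotonicity discards ⟪e, p⟫, and the rest is ⟪p
- q, e - c⟫, bounded by the Lipschitz estimate and 2ab ≤ a² + b². -/
theorem neg_inner_sub_inner_le_of_lipschitz {s : ℝ} (hs : 0 ≤ s) {c e p q r : H}
    (he : 0 ≤ ⟪e, p⟫_ℝ) (hce : ‖e - c‖ ≤ s * ‖p - r‖) :
    -⟪p - q, c⟫_ℝ - ⟪q, e⟫_ℝ ≤ s / 2 * ‖p - q‖ ^ 2 + s / 2 * ‖p - r‖ ^ 2 := by
  have h1 : -⟪p - q, c⟫_ℝ - ⟪q, e⟫_ℝ = -⟪e, p⟫_ℝ + ⟪p - q, e - c⟫_ℝ := by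
    rw [inner_sub_left, inner_sub_left, inner_sub_right, inner_sub_right, real_inner_comm p e]
    ring
  have h2 := real_inner_le_norm (p - q) (e - c)
  have h3 := mul_le_mul_of_nonneg_left hce (norm_nonneg (p - q))
  have h4 := mul_nonneg hs (sq_nonneg (‖p - q‖ - ‖p - r‖))
  linarith

end Stage

/-! ### The Fejér inequality and the identification of weak cluster points. -/

section Convergence

variable {H : Type*} [NormedAddCommGroup H] [InnerProductSpace ℝ H] {n m l : ℕ}
  {S : Coeffs n m l} {σ : Fin m → ℝ} {L : Fin l → ℝ}
  {A : Fin n → H → Set H} {B : Fin m → H → H} {C : Fin l → H → H}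

/-- Monotonicity of the A_i is applied between x and the constant solution. The `lower` term yields
-½⟨y, Ky⟩, and (c) makes this pay for the errors from B and C with ½‖M*x‖² to spare. -/
theorem Coeffs.Admissible.norm_sq_le_inner (hS : S.Admissible σ L)
    (hA : ∀ i, MaximallyMonotone (A i)) (hB : ∀ j, Cocoercive (σ j) (B j)) (hL : ∀ j, 0 < L j)
    (hC : ∀ j, MonotoneOperator (C j)) (hCL : ∀ j, LipschitzWith (L j).toNNReal (C j))
    {z z' : Power H (n - 1)} {x : Power H n} {u : H}
    (hx : ∀ i, S.selection B C z x i ∈ A i (x i))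
    (hu : ∀ i, S.selection B C z' (constPower n u) i ∈ A i u) :
    ‖kron S.M.transpose x‖ ^ 2 ≤ 2 * ⟪z - z', kron S.M.transpose x⟫_ℝ := by
  have hσ : ∀ j, 0 < σ j := fun j => (hB j).1
  set y := x - constPower n u with hy
  have hMy : kron S.M.transpose y = kron S.M.transpose x := by
    have : kron S.M.transpose (constPower n u) = 0 := by
      ext j
      simp only [constPower, kron_const_apply, hS.M_sum hσ hL, Pi.zero_apply, zero_smul,
        PiLp.zero_apply]
    rw [hy, kron_sub, this, sub_zero]
  have hconst : ∀ {p : ℕ} (Y : Matrix (Fin p) (Fin n) ℝ), Y.mulVec 1 = 1 →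
      ∀ j, kron Y y j = kron Y x j - u := by
    intro p Y hY j
    rw [hy, kron_sub, PiLp.sub_apply, constPower, kron_const_apply, hY, Pi.one_apply, one_smul]
  set b : Power H m := blockwise B (kron S.G x) - WithLp.toLp 2 fun j => B j u with hb
  set c : Power H l := blockwise C (kron S.R x) - WithLp.toLp 2 fun j => C j u with hc
  set e : Power H l := blockwise C (kron S.P.transpose x) - WithLp.toLp 2 fun j => C j u with he
  have hdiff : S.selection B C z x - S.selection B C z' (constPower n u)
      = S.selectionOf (z - z') y b c e := by
    rw [selection_const hS, selection, selectionOf, selectionOf, selectionOf, hb, hc, he, hy]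
    simp only [kron_sub]
    abel
  have h0 : 0 ≤ ⟪y, S.selectionOf (z - z') y b c e⟫_ℝ := by
    rw [← hdiff, PiLp.inner_apply]
    exact Finset.sum_nonneg fun i _ => (hA i).inner_nonneg (hx i) (hu i)
  rw [selectionOf, inner_sub_right, inner_sub_right, inner_sub_right, inner_add_right,
    inner_lower_kron hS.K_symm, inner_kron S.M, inner_kron S.H, inner_kron (S.P - S.Q),
    inner_kron S.Q, hMy, PiLp.inner_apply _ b, PiLp.inner_apply _ c, PiLp.inner_apply _ e] at h0
  simp only [Matrix.transpose_sub, sub_kron, PiLp.sub_apply] at h0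
  have hb' : ∑ j, -⟪kron S.H.transpose y j, b j⟫_ℝ
      ≤ ∑ j, (σ j)⁻¹ / 4 * ‖kron S.H.transpose y j - kron S.G y j‖ ^ 2 := by
    refine Finset.sum_le_sum fun j _ => neg_inner_le_of_cocoercive (hσ j) ?_
    rw [hconst _ hS.G_sum]
    exact (hB j).2 _ _
  have hc' : ∑ j, (-⟪kron S.P.transpose y j - kron S.Q.transpose y j, c j⟫_ℝ
        - ⟪kron S.Q.transpose y j, e j⟫_ℝ)
      ≤ ∑ j, (L j / 2 * ‖kron S.P.transpose y j - kron S.Q.transpose y j‖ ^ 2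
        + L j / 2 * ‖kron S.P.transpose y j - kron S.R y j‖ ^ 2) := by
    refine Finset.sum_le_sum fun j _ => neg_inner_sub_inner_le_of_lipschitz (hL j).le ?_ ?_
    · rw [hconst _ hS.P_sum]
      exact hC j _ _
    · rw [hconst _ hS.P_sum, hconst _ hS.R_sum, sub_sub_sub_cancel_right]
      have := (hCL j).norm_sub_le (kron S.P.transpose x j) (kron S.R x j)
      rw [Real.coe_toNNReal _ (hL j).le] at this
      simpa only [hc, he, PiLp.sub_apply, blockwise_apply, sub_sub_sub_cancel_right] using this
  have hK := hS.norm_sq_add_le hσ y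
  rw [hMy] at hK
  have e1 : ∑ j, (σ j)⁻¹ / 2 * ‖kron S.H.transpose y j - kron S.G y j‖ ^ 2
      = 2 * ∑ j, (σ j)⁻¹ / 4 * ‖kron S.H.transpose y j - kron S.G y j‖ ^ 2 := by
    rw [Finset.mul_sum]
    exact Finset.sum_congr rfl fun j _ => by ring
  have e2 : ∀ f : Fin l → ℝ, ∑ j, L j / 2 * f j = (∑ j, L j * f j) / 2 := fun f => by
    rw [Finset.sum_div]
    exact Finset.sum_congr rfl fun j _ => by ring
  rw [Finset.sum_add_distrib, e2, e2, Finset.sum_sub_distrib, Finset.sum_neg_distrib] at hc'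
  rw [Finset.sum_neg_distrib] at hb'
  rw [real_inner_comm (z - z')] at h0
  linarith

theorem Coeffs.Admissible.tendsto_sum_smul (hS : S.Admissible σ L) {ι : Type*} {F : Filter ι}
    {x : ι → Power H n} (hx : Tendsto (fun k => kron S.M.transpose (x k)) F (𝓝 0))
    {t : Fin n → ℝ} (ht : ∑ i, t i = 0) : Tendsto (fun k => ∑ i, t i • x k i) F (𝓝 0) := by
  obtain ⟨s, rfl⟩ := hS.exists_mulVec_eq ht
  have e : ∀ k, ∑ i, S.M.mulVec s i • x k i = ∑ j, s j • kron S.M.transpose (x k) j := by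
    intro k
    simp only [kron_apply, Matrix.mulVec, dotProduct, Finset.sum_smul, Finset.smul_sum, smul_smul,
      Matrix.transpose_apply]
    rw [Finset.sum_comm]
    simp only [mul_comm]
  simp only [e]
  have h : Tendsto (fun k => ∑ j, s j • kron S.M.transpose (x k) j) F
      (𝓝 (∑ j, s j • (0 : Power H (n - 1)) j)) :=
    tendsto_finsetSum _ fun j _ => (((PiLp.continuous_apply 2 _ j).tendsto _).comp hx).const_smul _
  simpa using h

theorem Coeffs.Admissible.tendsto_kron_sub (hS : S.Admissible σ L) {ι : Type*} {F : Filter ι}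
    {x : ι → Power H n} (hx : Tendsto (fun k => kron S.M.transpose (x k)) F (𝓝 0)) {p : ℕ}
    {Y : Matrix (Fin p) (Fin n) ℝ} (hY : Y.mulVec 1 = 1) (j : Fin p) (i : Fin n) :
    Tendsto (fun k => kron Y (x k) j - x k i) F (𝓝 0) := by
  have h := hS.tendsto_sum_smul hx (t := fun h => Y j h - if h = i then 1 else 0) (by
    have := congrFun hY j
    simp only [Matrix.mulVec, dotProduct, Pi.one_apply, mul_one] at this
    rw [Finset.sum_sub_distrib, this]
    simp)
  refine h.congr fun k => ?_
  simp [sub_smul, Finset.sum_sub_distrib]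

theorem Coeffs.Admissible.tendsto_apply_sub (hS : S.Admissible σ L) {ι : Type*} {F : Filter ι}
    {x : ι → Power H n} (hx : Tendsto (fun k => kron S.M.transpose (x k)) F (𝓝 0))
    (i i' : Fin n) : Tendsto (fun k => x k i - x k i') F (𝓝 0) := by
  have h := hS.tendsto_kron_sub hx (Y := 1) (Matrix.one_mulVec 1) i i'
  simpa [Matrix.one_apply, ite_smul] using h

theorem TendstoWeakly.kron_apply {p q : ℕ} {ι : Type*} {F : Filter ι} {f : ι → Power H q}
    {v : Power H q} (hf : ∀ j, TendstoWeakly (fun k => f k j) F (v j))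
    (X : Matrix (Fin p) (Fin q) ℝ) (i : Fin p) :
    TendstoWeakly (fun k => kron X (f k) i) F (kron X v i) :=
  TendstoWeakly.sum fun j => (hf j).const_smul (X i j)

/-- Weak cluster points of the iterates solve the stage equation with equal stages. -/
theorem Coeffs.Admissible.selection_mem_of_tendstoWeakly [CompleteSpace H]
    (hS : S.Admissible σ L) (hA : ∀ i, MaximallyMonotone (A i))
    (hB : ∀ j, Cocoercive (σ j) (B j)) (hL : ∀ j, 0 < L j)
    (hC : ∀ j, MonotoneOperator (C j)) (hCL : ∀ j, LipschitzWith (L j).toNNReal (C j))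
    {ι : Type*} {U : Ultrafilter ι} {z : ι → Power H (n - 1)} {x : ι → Power H n}
    (hx : ∀ k i, S.selection B C (z k) (x k) i ∈ A i (x k i))
    (hzb : NormBounded z) (hxb : ∀ i, NormBounded fun k => x k i)
    (hM : Tendsto (fun k => kron S.M.transpose (x k)) U (𝓝 0))
    {zbar : Power H (n - 1)} {u : H} (hz : TendstoWeakly z U zbar) {i₀ : Fin n}
    (hu : TendstoWeakly (fun k => x k i₀) U u) :
    ∀ i, S.selection B C zbar (constPower n u) i ∈ A i u := by
  have hσ : ∀ j, 0 < σ j := fun j => (hB j).1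
  have hbb : ∀ j, NormBounded fun k => blockwise B (kron S.G (x k)) j := fun j =>
    (NormBounded.kron_apply hxb S.G j).comp_lipschitz (hB j).lipschitzWith
  have hcb : ∀ j, NormBounded fun k => blockwise C (kron S.R (x k)) j := fun j =>
    (NormBounded.kron_apply hxb S.R j).comp_lipschitz (hCL j)
  have heb : ∀ j, NormBounded fun k => blockwise C (kron S.P.transpose (x k)) j := fun j =>
    (NormBounded.kron_apply hxb S.P.transpose j).comp_lipschitz (hCL j)
  have hsb : ∀ i, NormBounded fun k => S.selection B C (z k) (x k) i := fun i =>
    ((((NormBounded.kron_apply hxb S.lower i).add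
      (NormBounded.kron_apply (fun j => hzb.apply j) S.M i)).sub
      (NormBounded.kron_apply hbb S.H i)).sub (NormBounded.kron_apply hcb (S.P - S.Q) i)).sub
      (NormBounded.kron_apply heb S.Q i)
  choose b hb using fun j => exists_tendstoWeakly U (hbb j).choose_spec
  choose e he using fun j => exists_tendstoWeakly U (heb j).choose_spec
  -- The arguments Rx and P*x differ by a null family, so by the Lipschitz property both evaluations
  -- of C share the weak limit e.
  have hc : ∀ j, TendstoWeakly (fun k => blockwise C (kron S.R (x k)) j) U (e j) := by
    intro j
    refine (he j).of_sub ?_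
    have h1 := hS.tendsto_kron_sub hM hS.R_sum j i₀
    have h2 := hS.tendsto_kron_sub hM hS.P_sum j i₀
    have h3 : Tendsto (fun k => (L j).toNNReal * ‖kron S.R (x k) j - kron S.P.transpose (x k) j‖) U
        (𝓝 0) := by
      have := ((h1.sub h2).norm).const_mul ((L j).toNNReal : ℝ)
      simpa only [sub_sub_sub_cancel_right, sub_zero, norm_zero, mul_zero] using this
    exact squeeze_zero_norm (fun k => (hCL j).norm_sub_le _ _) h3
  have hxu : ∀ i, TendstoWeakly (fun k => x k i) U (constPower n u i) := fun i =>
    hu.of_sub (hS.tendsto_apply_sub hM i i₀)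
  have hs : ∀ i, TendstoWeakly (fun k => S.selection B C (z k) (x k) i) U
      (S.selectionOf zbar (constPower n u) (WithLp.toLp 2 b) (WithLp.toLp 2 e)
        (WithLp.toLp 2 e) i) := fun i =>
    ((((TendstoWeakly.kron_apply hxu S.lower i).add
      (TendstoWeakly.kron_apply (fun j => hz.apply j) S.M i)).sub
      (TendstoWeakly.kron_apply (v := WithLp.toLp 2 b) hb S.H i)).sub
      (TendstoWeakly.kron_apply (v := WithLp.toLp 2 e) hc (S.P - S.Q) i)).sub
      (TendstoWeakly.kron_apply (v := WithLp.toLp 2 e) he S.Q i)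
  choose rs hrs using hsb
  choose rb hrb using hbb
  choose re hre using heb
  obtain ⟨R, hR⟩ := hxb i₀
  -- Neither B nor C need be weakly continuous; joining them to the A_i lets demiclosedness identify
  -- b and e as their values at u.
  let 𝒜 : Fin n ⊕ Fin m ⊕ Fin l → H → Set H :=
    Sum.elim A (Sum.elim (fun j x => {B j x}) fun j x => {C j x})
  have h𝒜 : ∀ i, MaximallyMonotone (𝒜 i) := by
    rintro (i | j | j)
    · exact hA i
    · exact (hB j).monotoneOperator.maximallyMonotone (hB j).lipschitzWith.continuous
    · exact (hC j).maximallyMonotone (hCL j).continuous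
  let X : Fin n ⊕ Fin m ⊕ Fin l → ι → H :=
    Sum.elim (fun i k => x k i) (Sum.elim (fun j k => kron S.G (x k) j)
      fun j k => kron S.P.transpose (x k) j)
  let a : Fin n ⊕ Fin m ⊕ Fin l → ι → H :=
    Sum.elim (fun i k => S.selection B C (z k) (x k) i)
      (Sum.elim (fun j k => blockwise B (kron S.G (x k)) j)
        fun j k => blockwise C (kron S.P.transpose (x k)) j)
  let abar : Fin n ⊕ Fin m ⊕ Fin l → H :=
    Sum.elim (fun i => S.selectionOf zbar (constPower n u) (WithLp.toLp 2 b) (WithLp.toLp 2 e)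
        (WithLp.toLp 2 e) i) (Sum.elim b e)
  let r : Fin n ⊕ Fin m ⊕ Fin l → ℝ := Sum.elim rs (Sum.elim rb re)
  have hmem : ∀ i, abar i ∈ 𝒜 i u := by
    refine mem_of_tendstoWeakly (R' := ∑ i, |r i|) h𝒜 (x := X) (a := a) (s := 0) ?_ hR ?_ hu ?_ ?_ ?_
    · rintro (i | j | j) k
      · exact hx k i
      · exact Set.mem_singleton _
      · exact Set.mem_singleton _
    · intro i k
      refine le_trans ?_ ((le_abs_self _).trans
        (Finset.single_le_sum (f := fun i => |r i|) (fun _ _ => abs_nonneg _) (Finset.mem_univ i)))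
      rcases i with i | j | j
      · exact hrs i k
      · exact hrb j k
      · exact hre j k
    · rintro (i | j | j)
      · exact hS.tendsto_apply_sub hM i i₀
      · exact hS.tendsto_kron_sub hM hS.G_sum j i₀
      · exact hS.tendsto_kron_sub hM hS.P_sum j i₀
    · rintro (i | j | j)
      · exact hs i
      · exact hb j
      · exact he j
    -- The selected elements sum to a combination of the stages with total weight 0, hence tend
    -- strongly to 0 in sum.
    · refine (hS.tendsto_sum_smul hM hS.sum_lower).congr fun k => ?_
      rw [Fintype.sum_sum_type, Fintype.sum_sum_type, ← add_assoc]
      exact (hS.sum_selectionOf hσ hL (z k) (x k) _ _ _).symm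
  have hbu : b = fun j => B j u := funext fun j => hmem (Sum.inr (Sum.inl j))
  have heu : e = fun j => C j u := funext fun j => hmem (Sum.inr (Sum.inr j))
  intro i
  have := hmem (Sum.inl i)
  rw [selection_const hS, ← hbu, ← heu]
  exact this

end Convergence

end Splitting

/-! ### Assembly of the convergence statements. -/

theorem mainTheorem1
    {H : Type*} [NormedAddCommGroup H] [InnerProductSpace ℝ H] [CompleteSpace H]
    (n m l : ℕ) (hn : 2 ≤ n)
    (A : Fin n → H → Set H) (hA : ∀ i, Splitting.MaximallyMonotone (A i))
    (σ : Fin m → ℝ) (B : Fin m → H → H) (hB : ∀ j, Splitting.Cocoercive (σ j) (B j))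
    (L : Fin l → ℝ) (hL : ∀ j, 0 < L j) (C : Fin l → H → H)
    (hC : ∀ j, Splitting.MonotoneOperator (C j))
    (hCL : ∀ j, LipschitzWith (L j).toNNReal (C j))
    (hzer : (Splitting.zerosOfSum A B C).Nonempty)
    (S : Splitting.Coeffs n m l) (hS : S.Admissible σ L)
    (γs : ℕ → ℝ) (hγs : ∀ k, γs k ∈ Set.Icc (0 : ℝ) 1)
    (hliminf : 0 < liminf (fun k => γs k * (1 - γs k)) atTop)
    (z : ℕ → Splitting.Power H (n - 1)) (x : ℕ → Splitting.Power H n)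
    (hzx : S.Generates A B C γs z x)
    (γ : ℝ) (hγ : 0 < γ) :
    Tendsto (fun k => z k - S.T A B C γ (z k)) atTop (𝓝 0) ∧
    (fun k : ℕ => ‖(1 / ((k : ℝ) + 1)) •
        ∑ s ∈ Finset.range (k + 1), (z s - S.T A B C γ (z s))‖)
      =O[atTop] (fun k : ℕ => 1 / Real.sqrt (k : ℝ)) ∧
    (∀ t : Fin n → ℝ, ∑ i, t i = 0 → Tendsto (fun k => ∑ i, t i • x k i) atTop (𝓝 0)) ∧
    ∃ (zbar : Splitting.Power H (n - 1)) (xbar : H),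
      zbar ∈ Function.fixedPoints (S.T A B C γ) ∧
      Tendsto (fun k => toWeakSpace ℝ (Splitting.Power H (n - 1)) (z k)) atTop
        (𝓝 (toWeakSpace ℝ (Splitting.Power H (n - 1)) zbar)) ∧
      Tendsto (fun k => toWeakSpace ℝ (Splitting.Power H n) (x k)) atTop
        (𝓝 (toWeakSpace ℝ (Splitting.Power H n) (WithLp.toLp 2 fun _ => xbar))) ∧
      xbar = Splitting.resolvent (S.d ⟨0, by omega⟩) (A ⟨0, by omega⟩)
        (S.d ⟨0, by omega⟩ • ∑ j, S.M ⟨0, by omega⟩ j • zbar j) ∧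
      xbar ∈ Splitting.zerosOfSum A B C := by
  open Splitting in
  have hσ : ∀ j, 0 < σ j := fun j => (hB j).1
  have hK := hS.K_pos hσ hL hn
  have hd : ∀ i, 0 < S.d i := fun i => div_pos two_pos (hK i)
  have hst := hzx.eq_stageMap hS
  have hsel : ∀ k i, S.selection B C (z k) (x k) i ∈ A i (x k i) := fun k =>
    (Coeffs.eq_stageMap_iff hA hK).1 (hst k)
  have hT : ∀ k, z k - S.T A B C γ (z k) = γ • kron S.M.transpose (x k) := by
    intro k
    rw [Coeffs.T, hS.stagePoint_eq (hst k), sub_sub_cancel]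
  have hzs : ∀ k, z (k + 1) = z k - γs k • kron S.M.transpose (x k) := by
    intro k
    ext j
    rw [hzx.z_eq k j]
    rfl
  set Ω : Set (Power H (n - 1)) :=
    {p | ∃ u, ∀ i, S.selection B C p (constPower n u) i ∈ A i u}
  have hstep : ∀ p ∈ Ω, ∀ k, ‖z (k + 1) - p‖ ^ 2
      + γs k * (1 - γs k) * ‖kron S.M.transpose (x k)‖ ^ 2 ≤ ‖z k - p‖ ^ 2 := by
    rintro p ⟨u, hu⟩ k
    have h := mul_le_mul_of_nonneg_left
      (hS.norm_sq_le_inner hA hB hL hC hCL (hsel k) hu) (hγs k).1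
    rw [hzs, sub_right_comm, norm_sub_sq_real, inner_smul_right, norm_smul, mul_pow,
      Real.norm_eq_abs, sq_abs]
    linarith
  have hanti : ∀ p ∈ Ω, Antitone fun k => ‖z k - p‖ := fun p hp =>
    antitone_nat_of_succ_le fun k => by
      refine le_of_sq_le_sq ?_ (norm_nonneg _)
      have h1 := hstep p hp k
      have h2 := mul_nonneg (mul_nonneg (hγs k).1 (sub_nonneg.2 (hγs k).2))
        (sq_nonneg ‖kron S.M.transpose (x k)‖)
      linarith
  obtain ⟨u₀, hu₀⟩ := hzer
  obtain ⟨p₀, hp₀⟩ := exists_selection_of_mem_zerosOfSum hS hσ hL (by omega) hu₀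
  have hp₀Ω : p₀ ∈ Ω := ⟨u₀, hp₀⟩
  have hsum : Summable fun k => ‖kron S.M.transpose (x k)‖ ^ 2 := by
    have h1 : Summable fun k => γs k * (1 - γs k) * ‖kron S.M.transpose (x k)‖ ^ 2 := by
      refine summable_of_sum_range_le (c := ‖z 0 - p₀‖ ^ 2)
        (fun k => mul_nonneg (mul_nonneg (hγs k).1 (sub_nonneg.2 (hγs k).2)) (sq_nonneg _))
        fun N => ?_
      have h2 : ∑ k ∈ Finset.range N, γs k * (1 - γs k) * ‖kron S.M.transpose (x k)‖ ^ 2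
          ≤ ∑ k ∈ Finset.range N, (‖z k - p₀‖ ^ 2 - ‖z (k + 1) - p₀‖ ^ 2) :=
        Finset.sum_le_sum fun k _ => by linarith [hstep p₀ hp₀Ω k]
      rw [Finset.sum_range_sub'] at h2
      linarith [sq_nonneg ‖z N - p₀‖]
    -- Eventually γ_k(1 - γ_k) > δ > 0, so the weights can be removed from the summable series.
    obtain ⟨δ, hδ0, hδ⟩ := exists_between hliminf
    have hev : ∀ᶠ k in atTop, δ < γs k * (1 - γs k) :=
      eventually_lt_of_lt_liminf hδ ⟨0, eventually_map.2 (Eventually.of_forall fun k =>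
        mul_nonneg (hγs k).1 (sub_nonneg.2 (hγs k).2))⟩
    refine Summable.of_norm_bounded_eventually_nat (h1.mul_left δ⁻¹) ?_
    filter_upwards [hev] with k hk
    rw [Real.norm_of_nonneg (sq_nonneg _), inv_mul_eq_div, le_div_iff₀ hδ0, mul_comm]
    exact mul_le_mul_of_nonneg_right hk.le (sq_nonneg _)
  have hM : Tendsto (fun k => kron S.M.transpose (x k)) atTop (𝓝 0) := by
    rw [tendsto_zero_iff_norm_tendsto_zero]
    have := hsum.tendsto_atTop_zero.sqrt
    simpa only [Real.sqrt_sq (norm_nonneg _), Real.sqrt_zero] using this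
  have hzb : NormBounded z := by
    refine ⟨‖z 0 - p₀‖ + ‖p₀‖, fun k => ?_⟩
    have h1 := norm_add_le (z k - p₀) p₀
    rw [sub_add_cancel] at h1
    have h2 := hanti p₀ hp₀Ω (Nat.zero_le k)
    simp only at h2
    linarith
  set i₀ : Fin n := ⟨0, by omega⟩
  have hfirst : ∀ k, x k i₀ = resolvent (S.d i₀) (A i₀) (S.d i₀ • ∑ j, S.M i₀ j • z k j) :=
    fun k => by rw [← hS.stageMap_first (i := i₀) rfl (z k) (x k), ← hst k]
  have hxb₀ : NormBounded fun k => x k i₀ := by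
    have h1 : NormBounded fun k => S.d i₀ • ∑ j, S.M i₀ j • z k j :=
      NormBounded.comp_lipschitz (NormBounded.kron_apply (fun j => hzb.apply j) S.M i₀)
        (lipschitzWith_smul (S.d i₀))
    have hlip : LipschitzWith 1 (resolvent (S.d i₀) (A i₀)) := LipschitzWith.mk_one fun v w => by
      rw [dist_eq_norm, dist_eq_norm]
      exact (hA i₀).norm_resolvent_sub_le (hd i₀) v w
    simpa only [hfirst] using h1.comp_lipschitz hlip
  have hxb : ∀ i, NormBounded fun k => x k i := fun i => by
    simpa only [sub_add_cancel] using
      (NormBounded.of_tendsto (hS.tendsto_apply_sub hM i i₀)).add hxb₀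
  have hstage : ∀ {p u}, (∀ i, S.selection B C p (constPower n u) i ∈ A i u) →
      constPower n u = S.stageMap A B C p (constPower n u) := fun {p u} hpu =>
    (Coeffs.eq_stageMap_iff hA hK).2 hpu
  have hueq : ∀ {p u}, (∀ i, S.selection B C p (constPower n u) i ∈ A i u) →
      u = resolvent (S.d i₀) (A i₀) (S.d i₀ • ∑ j, S.M i₀ j • p j) := by
    intro p u hpu
    rw [← hS.stageMap_first (i := i₀) rfl p (constPower n u), ← hstage hpu]
    rfl
  have hlimit : ∀ U : Ultrafilter ℕ, ↑U ≤ (atTop : Filter ℕ) → ∀ p, TendstoWeakly z U p →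
      ∃ u, TendstoWeakly (fun k => x k i₀) U u ∧
        ∀ i, S.selection B C p (constPower n u) i ∈ A i u := by
    intro U hU p hp
    obtain ⟨R, hR⟩ := hxb₀
    obtain ⟨u, hu⟩ := exists_tendstoWeakly U hR
    exact ⟨u, hu, hS.selection_mem_of_tendstoWeakly hA hB hL hC hCL hsel hzb hxb
      (hM.mono_left hU) hp hu⟩
  obtain ⟨R, hR⟩ := hzb
  obtain ⟨zbar, ⟨xbar, hbar⟩, hzbar⟩ := exists_tendstoWeakly_of_fejer hR
    (Ω := Ω) (fun p hp => ⟨_, tendsto_atTop_ciInf (hanti p hp)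
      ⟨0, by rintro _ ⟨k, rfl⟩; exact norm_nonneg _⟩⟩)
    fun U hU p hp => (hlimit U hU p hp).imp fun _ h => h.2
  -- Resolvents need not be weakly continuous. Instead, along each ultrafilter the weak limit u of
  -- the first stage solves the equal-stage inclusion for `zbar`, and `hueq` expresses both u and
  -- `xbar` by the same resolvent value.
  have hxbar₀ : TendstoWeakly (fun k => x k i₀) atTop xbar := by
    intro y
    refine (tendsto_iff_ultrafilter _ _ _).2 fun U hU => ?_
    obtain ⟨u, hu, hsu⟩ := hlimit U hU zbar fun w => (hzbar w).mono_left hU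
    rw [hueq hbar, ← hueq hsu]
    exact hu y
  have hxbar : TendstoWeakly x atTop (constPower n xbar) :=
    TendstoWeakly.of_apply fun i => hxbar₀.of_sub (hS.tendsto_apply_sub hM i i₀)
  refine ⟨?_, ?_, fun t ht => hS.tendsto_sum_smul hM ht, zbar, xbar, ?_,
    hzbar.tendsto_toWeakSpace, hxbar.tendsto_toWeakSpace, hueq hbar,
    mem_zerosOfSum_of_selection hS hσ hL hbar⟩
  · simpa only [hT, smul_zero] using hM.const_smul γ
  · simp only [hT]
    refine isBigO_norm_average ?_
    simpa only [norm_smul, mul_pow] using hsum.mul_left (‖γ‖ ^ 2)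
  · rw [Function.mem_fixedPoints, Function.IsFixedPt, Coeffs.T, hS.stagePoint_eq (hstage hbar)]
    have : kron S.M.transpose (constPower n xbar) = 0 := by
      ext j
      simp only [constPower, kron_const_apply, hS.M_sum hσ hL, Pi.zero_apply, zero_smul,
        PiLp.zero_apply]
    rw [this, smul_zero, sub_zero]
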